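/- **Theorem 2.7.** Let $N\ge 1$ be an integer, $p>1$, $0<s<1$ with $ps<N$, and let $-ps<\beta<\frac{N-ps}{2}$. Put $$K(\sigma)=\int_{|y'|=1}\frac{dH^{N-1}(y')}{|x'-\sigma y'|^{N+ps}}\qquad(|x'|=1,\ \sigma>0,\ \sigma\neq 1),$$ where $x'$ is any unit vector of $\mathbb R^N$, and $$\Lambda(\gamma)=\int_1^{\infty}K(\sigma)(\sigma^{\gamma}-1)^{p-1}\left(\sigma^{N-1-\beta-\gamma(p-1)}-\sigma^{\beta+ps-1}\right)d\sigma ,\qquad \gamma_0=\frac{N-ps-2\beta}{p}.$$ Then the integral defining $\Lambda(\gamma_0)$ converges absolutely, $\Lambda(\gamma_0)>0$, and $$\Lambda(\gamma_0)=\int_0^\infty|1-\sigma^{-\gamma_0}|^{p-2}(1-\sigma^{-\gamma_0})\,\sigma^{N-\beta-1}K(\sigma)\,d\sigma$$ as a principal value at $\sigma=1$ (the limit as $\varepsilon\downarrow0$ of the absolutely convergent integrals over $\{\sigma>0:|\sigma-1|>\varepsilon\}$). For every real-valued $\phi\in C_0^\infty(\mathbb R^N)\setminus\{0\}$ the integrals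 $$E(\phi)=\int_{\mathbb R^N}\int_{\mathbb R^N}\frac{|\phi(x)-\phi(y)|^p}{|x-y|^{N+ps}|x|^\beta|y|^\beta}\,dx\,dy,\qquad D(\phi)=\int_{\mathbb R^N}\frac{|\phi(x)|^p}{|x|^{ps+2\beta}}\,dx$$ are finite and $D(\phi)>0$, and the best constant in the weighted fractional Hardy inequality is $$\inf_{\phi\in C_0^\infty(\mathbb R^N)\setminus\{0\}}\frac{E(\phi)}{D(\phi)}=2\Lambda(\gamma_0).$$ For $\beta=0$ this best constant is the Frank–Seiringer constant $$\Lambda_{N,p,s}=2\int_0^\infty|1-\sigma^{-\gamma}|^{p-2}(1-\sigma^{-\gamma})\,\sigma^{N-1}K(\sigma)\,d\sigma,\qquad \gamma=\frac{N-ps}{p},$$ the integral again being a principal value at $\sigma=1$. -/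

import Mathlib

open MeasureTheory Set Filter
open scoped ENNReal Topology ContDiff

noncomputable section

namespace WeightedHardy

/-- The weighted Gagliardo energy
`∬ |φ(x) - φ(y)|^p / (|x - y|^{N + p s} |x|^β |y|^β) dx dy`, with values in `[0, ∞]`. -/
def energy (N : ℕ) (p s β : ℝ) (φ : EuclideanSpace ℝ (Fin N) → ℝ) : ℝ≥0∞ :=
  ∫⁻ x, ∫⁻ y, ENNReal.ofReal
    (|φ x - φ y| ^ p / (‖x - y‖ ^ ((N : ℝ) + p * s) * ‖x‖ ^ β * ‖y‖ ^ β))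

/-- The weighted Hardy term `∫ |φ(x)|^p / |x|^{p s + 2 β} dx`, with values in `[0, ∞]`. -/
def hardyTerm (N : ℕ) (p s β : ℝ) (φ : EuclideanSpace ℝ (Fin N) → ℝ) : ℝ≥0∞ :=
  ∫⁻ x, ENNReal.ofReal (|φ x| ^ p / ‖x‖ ^ (p * s + 2 * β))

/-- The best constant: the infimum of the quotient of the energy by the Hardy term over the
nonzero smooth compactly supported functions on `ℝ^N`. -/
def bestConstant (N : ℕ) (p s β : ℝ) : ℝ≥0∞ :=
  ⨅ φ : {φ : EuclideanSpace ℝ (Fin N) → ℝ // ContDiff ℝ ∞ φ ∧ HasCompactSupport φ ∧ φ ≠ 0},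
    energy N p s β φ.1 / hardyTerm N p s β φ.1

/-- `K(σ) = ∫_{|y'| = 1} dH^{N-1}(y') / |x' - σ y'|^{N + p s}`, for a vector `x'` (of norm one).
The measure `volume.toSphere` is the usual surface measure of the unit sphere, normalized so that
integration in polar coordinates holds (it is the counting measure on `{1, -1}` if `N = 1`). -/
def sphereKernel (N : ℕ) (p s : ℝ) (x' : EuclideanSpace ℝ (Fin N)) (σ : ℝ) : ℝ :=
  ∫ y' : Metric.sphere (0 : EuclideanSpace ℝ (Fin N)) 1,
    1 / ‖x' - σ • (y' : EuclideanSpace ℝ (Fin N))‖ ^ ((N : ℝ) + p * s)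
    ∂(volume : Measure (EuclideanSpace ℝ (Fin N))).toSphere

/-- The integrand
`K(σ) (σ^γ - 1)^{p-1} (σ^{N - 1 - β - γ (p - 1)} - σ^{β + p s - 1})` on `(1, ∞)`. -/
def lambdaIntegrand (N : ℕ) (p s β γ : ℝ) (x' : EuclideanSpace ℝ (Fin N)) (σ : ℝ) : ℝ :=
  sphereKernel N p s x' σ * (σ ^ γ - 1) ^ (p - 1) *
    (σ ^ ((N : ℝ) - 1 - β - γ * (p - 1)) - σ ^ (β + p * s - 1))

/-- `Λ(γ)`, the integral of `lambdaIntegrand` over `(1, ∞)`. -/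
def Lam (N : ℕ) (p s β γ : ℝ) (x' : EuclideanSpace ℝ (Fin N)) : ℝ :=
  ∫ σ in Ioi (1 : ℝ), lambdaIntegrand N p s β γ x' σ

/-- `ψ(σ) = |1 - σ^{-γ}|^{p-2} (1 - σ^{-γ}) σ^{N - β - 1} K(σ)`. -/
def psi (N : ℕ) (p s β γ : ℝ) (x' : EuclideanSpace ℝ (Fin N)) (σ : ℝ) : ℝ :=
  |1 - σ ^ (-γ)| ^ (p - 2) * (1 - σ ^ (-γ)) * σ ^ ((N : ℝ) - β - 1) * sphereKernel N p s x' σ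

/-- `f` has the integral `L` over `(0, ∞)`, as a principal value at the point `1`. -/
def HasPVIntegral (f : ℝ → ℝ) (L : ℝ) : Prop :=
  (∀ ε : ℝ, 0 < ε → IntegrableOn f {σ : ℝ | 0 < σ ∧ ε < |σ - 1|}) ∧
    Tendsto (fun ε : ℝ => ∫ σ in {σ : ℝ | 0 < σ ∧ ε < |σ - 1|}, f σ) (𝓝[>] 0) (𝓝 L)

/-- `L` is the Frank-Seiringer constant
`2 ∫_0^∞ |1 - σ^{-γ}|^{p-2} (1 - σ^{-γ}) σ^{N - 1} K(σ) dσ` with `γ = (N - p s) / p`. -/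
def IsFrankSeiringerConstant (N : ℕ) (p s : ℝ) (x' : EuclideanSpace ℝ (Fin N)) (L : ℝ) : Prop :=
  HasPVIntegral (fun σ : ℝ =>
    2 * (|1 - σ ^ (-(((N : ℝ) - p * s) / p))| ^ (p - 2) * (1 - σ ^ (-(((N : ℝ) - p * s) / p))) *
      σ ^ ((N : ℝ) - 1) * sphereKernel N p s x' σ)) L

end WeightedHardy

end

noncomputable section

namespace WeightedHardy

/-! Logarithmic polar coordinates `x = e^t θ`, `y = e^(t+v) η` turn dilations into translations in
`t`. Put `F(θ,t) = e^(γt) φ(e^t θ)`. Because `pγ = N - ps - 2β`, the Hardy term becomes `‖F‖_p^p` on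
sphere × line (`hardyTerm_eq`). By symmetry the energy is twice its part over `‖x‖ < ‖y‖`, that is
`v > 0`, and this part is a superposition over `v`, with weight `e^((N-β)v)`, of the slices `∫∫∫ |θ
- e^v η|^(-(N+ps)) |F(θ,t) - c F(η,t+v)|^p` with `c = e^(-γv) < 1` (`energy_eq_lintegral_slice`).

Lower bound. In `L^p` of the slice measure, `F(θ,t)` and `F(η,t+v)` have the same norm, with `p`-th
power `K(e^v) ‖F‖_p^p`, by rotation and translation invariance. The triangle inequality gives the
factor `(1-c)^p` on each slice (`le_sliceEnergy`), and integrating over `v` gives exactly `Λ`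
(`lintegral_log_eq_Lam`).

Sharpness. Equality would need `F` constant, so one takes `F = f(t/R)` with a bump `f`. The relative
error is at most `4L/(γR)` on every slice simultaneously, since `c v ≤ (1-c)/γ`
(`lintegral_sub_exp_mul_shift_le`); letting `R → ∞` needs no limit theorem under the integral.

The principal value formula follows by folding `(0,1)` onto `(1,∞)` through `σ ↦ 1/σ`. The two
truncations then fail to match only on a window of length `O(ε²)`, whose contribution is
`O(ε^(p-ps))` (`hasPVIntegral_psi`). -/

/-- The Euclidean space `ℝ^N`. -/
abbrev Space (N : ℕ) := EuclideanSpace ℝ (Fin N)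

/-- The unit sphere of `ℝ^N`. -/
abbrev USphere (N : ℕ) := Metric.sphere (0 : Space N) 1

/-- The surface measure of the unit sphere of `ℝ^N`. -/
abbrev sphereMeasure (N : ℕ) : Measure (USphere N) := (volume : Measure (Space N)).toSphere

lemma norm_coe_sphere {N : ℕ} (θ : USphere N) : ‖(θ : Space N)‖ = 1 := by
  simp

lemma nontrivial_space {N : ℕ} (hN : 1 ≤ N) : Nontrivial (Space N) := by
  have : Nonempty (Fin N) := ⟨⟨0, hN⟩⟩
  infer_instance

/-! ### Polar coordinates -/

theorem lintegral_polar {N : ℕ} (hN : 1 ≤ N) {f : Space N → ℝ≥0∞} (hf : Measurable f) :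
    ∫⁻ x, f x = ∫⁻ θ, ∫⁻ r in Ioi (0 : ℝ), ENNReal.ofReal (r ^ (N - 1)) * f (r • (θ : Space N))
      ∂volume ∂sphereMeasure N := by
  have := nontrivial_space hN
  have hm := (volume : Measure (Space N)).measurePreserving_homeomorphUnitSphereProd
  have hdim : Module.finrank ℝ (Space N) = N := by simp
  rw [hdim] at hm
  calc ∫⁻ x, f x = ∫⁻ x in ({0}ᶜ : Set (Space N)), f x := by
        rw [restrict_compl_singleton]
    _ = ∫⁻ x : ({0}ᶜ : Set (Space N)), f x ∂(volume.comap Subtype.val) := by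
        rw [lintegral_subtype_comap (measurableSet_singleton _).compl]
    _ = ∫⁻ z, f (z.2.1 • (z.1 : Space N))
          ∂((sphereMeasure N).prod (Measure.volumeIoiPow (N - 1))) := by
        rw [← hm.lintegral_comp (by fun_prop)]
        refine lintegral_congr fun x => ?_
        have hx : ‖(x : Space N)‖ ≠ 0 := norm_ne_zero_iff.2 x.2
        simp [smul_smul, hx]
    _ = ∫⁻ θ, ∫⁻ r : Ioi (0 : ℝ), f (r.1 • (θ : Space N)) ∂(Measure.volumeIoiPow (N - 1))
          ∂sphereMeasure N := by
        rw [lintegral_prod _ (by fun_prop)]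
    _ = _ := by
        refine lintegral_congr fun θ => ?_
        rw [Measure.volumeIoiPow, lintegral_withDensity_eq_lintegral_mul _ (by fun_prop)
          (by fun_prop)]
        exact lintegral_subtype_comap measurableSet_Ioi
          (fun r : ℝ => ENNReal.ofReal (r ^ (N - 1)) * f (r • (θ : Space N)))

theorem setLIntegral_exp (g : ℝ → ℝ≥0∞) (s : Set ℝ) (hs : MeasurableSet s) :
    ∫⁻ r in Real.exp '' s, g r = ∫⁻ t in s, ENNReal.ofReal (Real.exp t) * g (Real.exp t) := by
  rw [lintegral_image_eq_lintegral_abs_deriv_mul hs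
    (fun x _ => (Real.hasDerivAt_exp x).hasDerivWithinAt) Real.exp_injective.injOn]
  simp [abs_of_pos, Real.exp_pos]

/-- With `r = e^t`, `r^(N-1) dr = e^(Nt) dt`. The radial measure becomes a weighted Lebesgue measure
on the whole line, so that shifts in `t` are available later. -/
theorem lintegral_polar_log {N : ℕ} (hN : 1 ≤ N) {f : Space N → ℝ≥0∞} (hf : Measurable f) :
    ∫⁻ x, f x = ∫⁻ θ, ∫⁻ t : ℝ, ENNReal.ofReal (Real.exp (N * t)) *
      f (Real.exp t • (θ : Space N)) ∂volume ∂sphereMeasure N := by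
  rw [lintegral_polar hN hf]
  refine lintegral_congr fun θ => ?_
  rw [← Real.range_exp, ← image_univ, setLIntegral_exp _ _ MeasurableSet.univ, setLIntegral_univ]
  refine lintegral_congr fun t => ?_
  rw [← mul_assoc, ← ENNReal.ofReal_mul (Real.exp_pos _).le, ← Real.exp_nat_mul, ← Real.exp_add]
  congr 3
  rw [Nat.cast_sub hN]
  push_cast
  ring

/-! ### Integrals of powers of the norm -/

lemma lintegral_exp_Iic {a : ℝ} (ha : 0 < a) (c : ℝ) :
    ∫⁻ t in Iic c, ENNReal.ofReal (Real.exp (a * t)) = ENNReal.ofReal (Real.exp (a * c) / a) := by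
  rw [← ofReal_integral_eq_lintegral_ofReal (integrableOn_exp_mul_Iic ha c)
    (ae_of_all _ fun _ => (Real.exp_pos _).le), integral_exp_mul_Iic ha]

lemma lintegral_exp_Ici {a : ℝ} (ha : 0 < a) (c : ℝ) :
    ∫⁻ t in Ici c, ENNReal.ofReal (Real.exp (-a * t)) =
      ENNReal.ofReal (Real.exp (-a * c) / a) := by
  rw [setLIntegral_congr Ioi_ae_eq_Ici.symm,
    ← ofReal_integral_eq_lintegral_ofReal (integrableOn_exp_mul_Ioi (neg_lt_zero.2 ha) c)
    (ae_of_all _ fun _ => (Real.exp_pos _).le), integral_exp_mul_Ioi (neg_lt_zero.2 ha),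
    neg_div_neg_eq]

theorem lintegral_radial {N : ℕ} (hN : 1 ≤ N) {f : ℝ → ℝ≥0∞} (hf : Measurable f) :
    ∫⁻ x : Space N, f ‖x‖ = sphereMeasure N univ *
      ∫⁻ t : ℝ, ENNReal.ofReal (Real.exp (N * t)) * f (Real.exp t) := by
  refine (lintegral_polar_log hN (hf.comp measurable_norm)).trans ?_
  simp only [Function.comp_apply, norm_smul, Real.norm_eq_abs, Real.abs_exp, norm_coe_sphere,
    mul_one]
  rw [lintegral_const, mul_comm]

theorem lintegral_norm_rpow_ball {N : ℕ} (hN : 1 ≤ N) {a r : ℝ} (ha : 0 < a) (hr : 0 < r) :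
    ∫⁻ x in {x : Space N | ‖x‖ ≤ r}, ENNReal.ofReal (‖x‖ ^ (a - N)) =
      sphereMeasure N univ * ENNReal.ofReal (r ^ a / a) := by
  have hs : MeasurableSet {x : Space N | ‖x‖ ≤ r} := measurableSet_le (by fun_prop) (by fun_prop)
  rw [← lintegral_indicator hs]
  have hm : Measurable ((Iic r).indicator fun u : ℝ => ENNReal.ofReal (u ^ (a - N))) :=
    Measurable.indicator (by fun_prop) measurableSet_Iic
  refine (lintegral_radial hN hm).trans ?_
  congr 1
  have := lintegral_exp_Iic ha (Real.log r)
  rw [mul_comm a, ← Real.rpow_def_of_pos hr] at this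
  rw [← this, ← lintegral_indicator measurableSet_Iic]
  refine lintegral_congr fun t => ?_
  have ht : Real.exp t ∈ Iic r ↔ t ∈ Iic (Real.log r) := (Real.le_log_iff_exp_le hr).symm
  by_cases h : t ∈ Iic (Real.log r)
  · rw [indicator_of_mem h, indicator_of_mem (ht.2 h), ← ENNReal.ofReal_mul (Real.exp_pos _).le,
      ← Real.exp_mul, ← Real.exp_add]
    congr 2
    ring
  · rw [indicator_of_notMem h, indicator_of_notMem (fun h' => h (ht.1 h')), mul_zero]

theorem lintegral_norm_rpow_compl_ball {N : ℕ} (hN : 1 ≤ N) {a r : ℝ} (ha : 0 < a) (hr : 0 < r) :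
    ∫⁻ x in {x : Space N | r ≤ ‖x‖}, ENNReal.ofReal (‖x‖ ^ (-a - N)) =
      sphereMeasure N univ * ENNReal.ofReal (r ^ (-a) / a) := by
  have hs : MeasurableSet {x : Space N | r ≤ ‖x‖} := measurableSet_le (by fun_prop) (by fun_prop)
  rw [← lintegral_indicator hs]
  have hm : Measurable ((Ici r).indicator fun u : ℝ => ENNReal.ofReal (u ^ (-a - N))) :=
    Measurable.indicator (by fun_prop) measurableSet_Ici
  refine (lintegral_radial hN hm).trans ?_
  congr 1
  have := lintegral_exp_Ici ha (Real.log r)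
  rw [mul_comm (-a) (Real.log r), ← Real.rpow_def_of_pos hr] at this
  rw [← this, ← lintegral_indicator measurableSet_Ici]
  refine lintegral_congr fun t => ?_
  have ht : Real.exp t ∈ Ici r ↔ t ∈ Ici (Real.log r) := (Real.log_le_iff_le_exp hr).symm
  by_cases h : t ∈ Ici (Real.log r)
  · rw [indicator_of_mem h, indicator_of_mem (ht.2 h), ← ENNReal.ofReal_mul (Real.exp_pos _).le,
      ← Real.exp_mul, ← Real.exp_add]
    congr 2
    ring
  · rw [indicator_of_notMem h, indicator_of_notMem (fun h' => h (ht.1 h')), mul_zero]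

/-! ### The spherical kernel -/

/-- The integral of `‖x - σ θ‖ ^ (-a)` over the unit sphere, with values in `[0, ∞]`. -/
def sphereLIntegral (N : ℕ) (a : ℝ) (x : Space N) (σ : ℝ) : ℝ≥0∞ :=
  ∫⁻ θ : USphere N, ENNReal.ofReal (1 / ‖x - σ • (θ : Space N)‖ ^ a) ∂sphereMeasure N

theorem measurable_sphereLIntegral (N : ℕ) (a : ℝ) (x : Space N) :
    Measurable (sphereLIntegral N a x) :=
  Measurable.lintegral_prod_right' (ν := sphereMeasure N)
    (f := fun z : ℝ × USphere N => ENNReal.ofReal (1 / ‖x - z.1 • (z.2 : Space N)‖ ^ a))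
    (by fun_prop)

/-- Rotation invariance of the surface measure is inherited from Lebesgue measure: the integral of
`g(x/‖x‖)` over the unit ball is `1/N` times the integral of `g` over the sphere, and the ball is
invariant under `e`. -/
theorem lintegral_sphere_comp_isometry {N : ℕ} (e : Space N ≃ₗᵢ[ℝ] Space N)
    {f : Space N → ℝ≥0∞} (hf : Measurable f) :
    ∫⁻ θ : USphere N, f (e θ) ∂sphereMeasure N = ∫⁻ θ : USphere N, f θ ∂sphereMeasure N := by
  rcases Nat.eq_zero_or_pos N with rfl | hN
  · have : sphereMeasure 0 = 0 := by
      rw [Measure.toSphere_eq_zero_iff_finrank]; simp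
    simp [this]
  have key : ∀ g : Space N → ℝ≥0∞, Measurable g →
      ∫⁻ x : Space N, ((Metric.closedBall 0 1).indicator (fun x => g (‖x‖⁻¹ • x))) x =
      (∫⁻ θ : USphere N, g θ ∂sphereMeasure N) *
        ENNReal.ofReal (Real.exp (N * 0) / N) := by
    intro g hg
    have hg' : Measurable fun x : Space N => g (‖x‖⁻¹ • x) := hg.comp (by fun_prop)
    rw [lintegral_polar_log hN (hg'.indicator Metric.isClosed_closedBall.measurableSet),
      ← lintegral_mul_const' _ _ (by finiteness)]
    refine lintegral_congr fun θ => ?_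
    rw [← lintegral_exp_Iic (by exact_mod_cast hN) 0, ← lintegral_indicator measurableSet_Iic,
      ← lintegral_const_mul _ (Measurable.indicator (by fun_prop) measurableSet_Iic)]
    refine lintegral_congr fun t => ?_
    have ht : Real.exp t • (θ : Space N) ∈ Metric.closedBall (0 : Space N) 1 ↔ t ∈ Iic (0 : ℝ) := by
      simp [norm_smul]
    have hn : ‖Real.exp t • (θ : Space N)‖⁻¹ • Real.exp t • (θ : Space N) = θ := by
      simp [norm_smul, smul_smul]
    by_cases h : t ∈ Iic (0 : ℝ)
    · rw [indicator_of_mem h, indicator_of_mem (ht.2 h), mul_comm, hn]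
    · rw [indicator_of_notMem h, indicator_of_notMem (fun h' => h (ht.1 h')), mul_zero, mul_zero]
  have hN' : (0 : ℝ) < N := by exact_mod_cast hN
  have h1 := key f hf
  have h2 := key (f ∘ e) (hf.comp e.continuous.measurable)
  have h3 := e.measurePreserving.lintegral_comp_emb e.toHomeomorph.measurableEmbedding
    ((Metric.closedBall 0 1).indicator (fun x => f (‖x‖⁻¹ • x)))
  have h4 : ∀ x, ((Metric.closedBall 0 1).indicator (fun x => f (‖x‖⁻¹ • x))) (e x) =
      ((Metric.closedBall 0 1).indicator (fun x => (f ∘ e) (‖x‖⁻¹ • x))) x := by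
    intro x
    simp [indicator]
  simp only [h4] at h3
  rw [h1, h2] at h3
  exact (ENNReal.mul_left_inj (by simp [hN']) (by finiteness)).1 h3

/-- The reflection in the hyperplane orthogonal to `x - y` carries `x` to `y` and preserves the
surface measure. -/
theorem sphereLIntegral_congr {N : ℕ} (a : ℝ) {x y : Space N} (h : ‖x‖ = ‖y‖) (σ : ℝ) :
    sphereLIntegral N a x σ = sphereLIntegral N a y σ := by
  set R := (ℝ ∙ (x - y))ᗮ.reflection
  have hR : R x = y := Submodule.reflection_sub h
  rw [sphereLIntegral, sphereLIntegral, ← lintegral_sphere_comp_isometry R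
    (f := fun z => ENNReal.ofReal (1 / ‖y - σ • z‖ ^ a)) (by fun_prop)]
  refine lintegral_congr fun θ => ?_
  rw [← hR, ← map_smul, ← map_sub, LinearIsometryEquiv.norm_map]

/-- Both squares are `(1 + σ²)‖x‖² - 2σ⟨x,y⟩`. This symmetry is behind both the inversion formula
for `K` and the equality of the two marginals of a slice. -/
lemma norm_sub_smul_comm {N : ℕ} {x y : Space N} (h : ‖x‖ = ‖y‖) (σ : ℝ) :
    ‖x - σ • y‖ = ‖y - σ • x‖ := by
  have : ‖x - σ • y‖ ^ 2 = ‖y - σ • x‖ ^ 2 := by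
    rw [norm_sub_sq_real, norm_sub_sq_real, norm_smul, norm_smul, inner_smul_right,
      inner_smul_right, real_inner_comm, h]
  exact (sq_eq_sq₀ (norm_nonneg _) (norm_nonneg _)).1 this

lemma sub_one_le_norm_sub_smul {N : ℕ} {x y : Space N} (hx : ‖x‖ = 1) (hy : ‖y‖ = 1) {σ : ℝ}
    (hσ : 0 ≤ σ) : σ - 1 ≤ ‖x - σ • y‖ := by
  have := norm_sub_norm_le (σ • y) x
  rw [norm_smul, hx, hy, Real.norm_of_nonneg hσ, norm_sub_rev] at this
  linarith

/-- Pointwise on the sphere, `‖x - σ⁻¹θ‖ = σ⁻¹‖θ - σx‖ = σ⁻¹‖x - σθ‖`. -/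
theorem sphereLIntegral_inv {N : ℕ} (a : ℝ) {x : Space N} (hx : ‖x‖ = 1) {σ : ℝ} (hσ : 0 < σ) :
    sphereLIntegral N a x σ⁻¹ = ENNReal.ofReal (σ ^ a) * sphereLIntegral N a x σ := by
  rw [sphereLIntegral, sphereLIntegral, ← lintegral_const_mul' _ _ ENNReal.ofReal_ne_top]
  refine lintegral_congr fun θ => ?_
  rw [← ENNReal.ofReal_mul (by positivity)]
  have : x - σ⁻¹ • (θ : Space N) = (-σ⁻¹) • ((θ : Space N) - σ • x) := by
    rw [smul_sub, smul_smul, neg_mul, inv_mul_cancel₀ hσ.ne', neg_smul, neg_smul, one_smul]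
    abel
  rw [this, norm_smul, norm_neg, norm_inv, Real.norm_of_nonneg hσ.le,
    norm_sub_smul_comm (by simp [hx] : ‖(θ : Space N)‖ = ‖x‖),
    Real.mul_rpow (by positivity) (by positivity), Real.inv_rpow hσ.le]
  congr 1
  have : σ ^ a ≠ 0 := (Real.rpow_pos_of_pos hσ a).ne'
  rw [one_div, mul_inv, inv_inv, one_div]

theorem sphereLIntegral_le_of_one_lt {N : ℕ} {a : ℝ} (ha : 0 ≤ a) {x : Space N} (hx : ‖x‖ = 1)
    {σ : ℝ} (hσ : 1 < σ) :
    sphereLIntegral N a x σ ≤ sphereMeasure N univ * ENNReal.ofReal ((σ - 1) ^ (-a)) := by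
  rw [mul_comm, ← lintegral_const, sphereLIntegral]
  refine lintegral_mono fun θ => ENNReal.ofReal_le_ofReal ?_
  have h0 : 0 < σ - 1 := sub_pos.2 hσ
  rw [Real.rpow_neg h0.le, one_div]
  have := sub_one_le_norm_sub_smul hx (norm_coe_sphere θ) (zero_le_one.trans hσ.le)
  gcongr

/-- Averaging over the radii in `[σ, 2 σ - 1]` bounds the spherical kernel near the sphere. -/
theorem sphereLIntegral_le_near {N : ℕ} (hN : 1 ≤ N) {b : ℝ} (hb : 0 < b) {x : Space N}
    (hx : ‖x‖ = 1) {σ : ℝ} (hσ : 1 < σ) :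
    sphereLIntegral N (N + b) x σ ≤
      sphereMeasure N univ * ENNReal.ofReal (2 ^ (N + b) / b * (σ - 1) ^ (-1 - b)) := by
  set δ := σ - 1 with hδ
  have h0 : 0 < δ := sub_pos.2 hσ
  -- The factor `2^(N+b)` pays for replacing the radius `σ` by any `r` in `[σ, 2σ - 1]`. The
  -- integral of `F` is computed by centring at `x`, since its support has distance at least `δ`
  -- from `x`.
  set F : Space N → ℝ≥0∞ := {y | σ ≤ ‖y‖}.indicator
    (fun y => ENNReal.ofReal (2 ^ (N + b) / ‖x - y‖ ^ (N + b))) with hF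
  have hs : MeasurableSet {y : Space N | σ ≤ ‖y‖} := measurableSet_le (by fun_prop) (by fun_prop)
  have hFm : Measurable F := Measurable.indicator (by fun_prop) hs
  have h1 : ∫⁻ y, F y ≤ sphereMeasure N univ * ENNReal.ofReal (2 ^ (N + b) / b * δ ^ (-b)) := by
    calc ∫⁻ y, F y ≤ ∫⁻ y, {z : Space N | δ ≤ ‖z‖}.indicator
          (fun z => ENNReal.ofReal (2 ^ (N + b)) * ENNReal.ofReal (‖z‖ ^ (-b - N))) (x - y) := by
          refine lintegral_mono fun y => ?_
          by_cases hy : σ ≤ ‖y‖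
          · have h2 : δ ≤ ‖x - y‖ := by
              have := norm_sub_norm_le y x
              rw [hx, norm_sub_rev] at this
              linarith
            rw [hF, indicator_of_mem (show y ∈ {y : Space N | σ ≤ ‖y‖} from hy),
              indicator_of_mem (show x - y ∈ {z : Space N | δ ≤ ‖z‖} from h2),
              ← ENNReal.ofReal_mul (by positivity)]
            rw [show -b - (N : ℝ) = -(N + b) by ring, Real.rpow_neg (norm_nonneg _), div_eq_mul_inv]
          · rw [hF, indicator_of_notMem (show y ∉ {y : Space N | σ ≤ ‖y‖} from hy)]
            exact zero_le
      _ = ∫⁻ z, {z : Space N | δ ≤ ‖z‖}.indicator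
          (fun z => ENNReal.ofReal (2 ^ (N + b)) * ENNReal.ofReal (‖z‖ ^ (-b - N))) z :=
          lintegral_sub_left_eq_self _ x
      _ = _ := by
          rw [lintegral_indicator (measurableSet_le (by fun_prop) (by fun_prop)),
            lintegral_const_mul _ (by fun_prop), lintegral_norm_rpow_compl_ball hN hb h0,
            mul_left_comm, ← ENNReal.ofReal_mul (by positivity)]
          congr 2
          ring
  have h2 : ENNReal.ofReal δ * sphereLIntegral N (N + b) x σ ≤ ∫⁻ y, F y := by
    rw [lintegral_polar hN hFm, lintegral_lintegral_swap (by fun_prop)]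
    calc ENNReal.ofReal δ * sphereLIntegral N (N + b) x σ
        = ∫⁻ r in Icc σ (σ + δ), sphereLIntegral N (N + b) x σ := by
          rw [setLIntegral_const, Real.volume_Icc, mul_comm]
          congr 2
          ring
      _ ≤ ∫⁻ r in Icc σ (σ + δ), ∫⁻ θ : USphere N, ENNReal.ofReal (r ^ (N - 1)) *
            F (r • (θ : Space N)) ∂sphereMeasure N := by
          refine setLIntegral_mono' measurableSet_Icc fun r hr => lintegral_mono fun θ => ?_
          have hr1 : 1 ≤ r := hσ.le.trans hr.1
          have hr0 : 0 ≤ r := zero_le_one.trans hr1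
          have hmem : r • (θ : Space N) ∈ {y : Space N | σ ≤ ‖y‖} := by
            simpa [norm_smul, abs_of_nonneg hr0] using hr.1
          rw [hF, indicator_of_mem hmem]
          refine le_trans ?_ (le_mul_of_one_le_left' (ENNReal.one_le_ofReal.2 (one_le_pow₀ hr1)))
          refine ENNReal.ofReal_le_ofReal ?_
          have hd : δ ≤ ‖x - σ • (θ : Space N)‖ :=
            sub_one_le_norm_sub_smul hx (norm_coe_sphere θ) (zero_le_one.trans hσ.le)
          have hd' : δ ≤ ‖x - r • (θ : Space N)‖ :=
            le_trans (by linarith [hr.1])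
              (sub_one_le_norm_sub_smul hx (norm_coe_sphere θ) hr0)
          -- The displacement `r - σ ≤ δ` is itself at most `‖x - σθ‖`.
          have h3 : ‖x - r • (θ : Space N)‖ ≤ 2 * ‖x - σ • (θ : Space N)‖ := by
            have : x - r • (θ : Space N) = (x - σ • (θ : Space N)) - (r - σ) • (θ : Space N) := by
              rw [sub_smul]; abel
            rw [this]
            refine (norm_sub_le _ _).trans ?_
            rw [norm_smul, norm_coe_sphere, Real.norm_of_nonneg (sub_nonneg.2 hr.1)]
            linarith [hr.2]
          have p1 : 0 < ‖x - σ • (θ : Space N)‖ := h0.trans_le hd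
          have p2 : 0 < ‖x - r • (θ : Space N)‖ := h0.trans_le hd'
          rw [div_le_div_iff₀ (by positivity) (by positivity), one_mul,
            ← Real.mul_rpow (by positivity) (by positivity)]
          exact Real.rpow_le_rpow p2.le h3 (by positivity)
      _ ≤ _ := lintegral_mono_set fun r hr => (zero_lt_one.trans hσ).trans_le hr.1
  have h3 := h2.trans h1
  rw [mul_comm, ← ENNReal.le_div_iff_mul_le (Or.inl (by simpa using h0)) (Or.inl (by finiteness)),
    mul_div_assoc, ← ENNReal.ofReal_div_of_pos h0] at h3
  refine h3.trans_eq ?_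
  congr 2
  rw [show -1 - b = -b - 1 by ring, Real.rpow_sub_one h0.ne']
  ring

theorem sphereLIntegral_ne_top {N : ℕ} {a : ℝ} (ha : 0 ≤ a) {x : Space N} (hx : ‖x‖ = 1)
    {σ : ℝ} (hσ : 1 < σ) : sphereLIntegral N a x σ ≠ ⊤ :=
  ne_top_of_le_ne_top (by finiteness) (sphereLIntegral_le_of_one_lt ha hx hσ)

theorem sphereKernel_eq_toReal (N : ℕ) (p s : ℝ) (x : Space N) (σ : ℝ) :
    sphereKernel N p s x σ = (sphereLIntegral N (N + p * s) x σ).toReal := by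
  rw [sphereKernel, sphereLIntegral, integral_eq_lintegral_of_nonneg_ae]
  · exact ae_of_all _ fun θ => by positivity
  · exact Measurable.aestronglyMeasurable (by fun_prop)

theorem ofReal_sphereKernel {N : ℕ} {p s : ℝ} (h : 0 ≤ p * s) {x : Space N} (hx : ‖x‖ = 1) {σ : ℝ}
    (hσ : 1 < σ) :
    ENNReal.ofReal (sphereKernel N p s x σ) = sphereLIntegral N (N + p * s) x σ := by
  rw [sphereKernel_eq_toReal, ENNReal.ofReal_toReal]
  exact sphereLIntegral_ne_top (by positivity) hx hσ

theorem measurable_sphereKernel (N : ℕ) (p s : ℝ) (x : Space N) :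
    Measurable (sphereKernel N p s x) := by
  simp only [funext (sphereKernel_eq_toReal N p s x)]
  exact (measurable_sphereLIntegral N _ x).ennreal_toReal

theorem sphereKernel_nonneg (N : ℕ) (p s : ℝ) (x : Space N) (σ : ℝ) :
    0 ≤ sphereKernel N p s x σ := by
  rw [sphereKernel_eq_toReal]; positivity

theorem sphereKernel_pos {N : ℕ} (hN : 1 ≤ N) {p s : ℝ} (h : 0 ≤ p * s) {x : Space N}
    (hx : ‖x‖ = 1) {σ : ℝ} (hσ : 1 < σ) : 0 < sphereKernel N p s x σ := by
  rw [sphereKernel_eq_toReal]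
  refine ENNReal.toReal_pos (fun h0 => ?_) (sphereLIntegral_ne_top (by positivity) hx hσ)
  rw [sphereLIntegral, lintegral_eq_zero_iff (by fun_prop)] at h0
  have := nontrivial_space hN
  have hne : (ae (sphereMeasure N)).NeBot := ae_neBot.2 (Measure.toSphere_ne_zero _)
  obtain ⟨θ, hθ⟩ := h0.exists
  have hd := sub_one_le_norm_sub_smul hx (norm_coe_sphere θ) (zero_le_one.trans hσ.le)
  have hd' : 0 < ‖x - σ • (θ : Space N)‖ := by linarith
  have : 0 < 1 / ‖x - σ • (θ : Space N)‖ ^ ((N : ℝ) + p * s) := by positivity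
  simp only [Pi.zero_apply, ENNReal.ofReal_eq_zero] at hθ
  linarith

theorem sphereKernel_inv {N : ℕ} {p s : ℝ} {x : Space N} (hx : ‖x‖ = 1) {σ : ℝ} (hσ : 0 < σ) :
    sphereKernel N p s x σ⁻¹ = σ ^ ((N : ℝ) + p * s) * sphereKernel N p s x σ := by
  rw [sphereKernel_eq_toReal, sphereKernel_eq_toReal, sphereLIntegral_inv _ hx hσ,
    ENNReal.toReal_mul, ENNReal.toReal_ofReal (by positivity)]

/-- The first bound serves near `σ = 1`, where averaging over the sphere improves the exponent `N +
ps` to `1 + ps`; the second gives the decay at infinity. -/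
theorem exists_sphereKernel_le {N : ℕ} (hN : 1 ≤ N) {p s : ℝ} (h : 0 < p * s) {x : Space N}
    (hx : ‖x‖ = 1) : ∃ C : ℝ, 0 < C ∧ ∀ σ : ℝ, 1 < σ →
      sphereKernel N p s x σ ≤ C * (σ - 1) ^ (-1 - p * s) ∧
      sphereKernel N p s x σ ≤ C * (σ - 1) ^ (-((N : ℝ) + p * s)) := by
  set m := (sphereMeasure N).real univ with hm
  have hm0 : 0 ≤ m := measureReal_nonneg
  refine ⟨m * (2 ^ (N + p * s) / (p * s)) + m + 1, by positivity, fun σ hσ => ?_⟩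
  have h0 : 0 < σ - 1 := sub_pos.2 hσ
  rw [sphereKernel_eq_toReal]
  constructor
  · have h1 := ENNReal.toReal_mono (by finiteness) (sphereLIntegral_le_near hN h hx hσ)
    rw [ENNReal.toReal_mul, ENNReal.toReal_ofReal (by positivity), ← mul_assoc] at h1
    refine h1.trans (mul_le_mul_of_nonneg_right ?_ (by positivity))
    change m * _ ≤ _
    linarith
  · have h1 := ENNReal.toReal_mono (by finiteness)
      (sphereLIntegral_le_of_one_lt (a := N + p * s) (by positivity) hx hσ)
    rw [ENNReal.toReal_mul, ENNReal.toReal_ofReal (by positivity)] at h1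
    refine h1.trans (mul_le_mul_of_nonneg_right ?_ (by positivity))
    change m ≤ _
    have : 0 ≤ m * (2 ^ (N + p * s) / (p * s)) := by positivity
    linarith

/-! ### Admissible parameters -/

/-- The range of parameters in the weighted fractional Hardy inequality. -/
structure Admissible (N : ℕ) (p s β γ : ℝ) : Prop where
  one_lt_p : 1 < p
  s_pos : 0 < s
  s_lt_one : s < 1
  ps_lt : p * s < N
  lt_β : -(p * s) < β
  β_lt : β < ((N : ℝ) - p * s) / 2
  p_mul_γ : p * γ = (N : ℝ) - p * s - 2 * β

namespace Admissible

variable {N : ℕ} {p s β γ : ℝ}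

lemma p_pos (h : Admissible N p s β γ) : 0 < p := zero_lt_one.trans h.one_lt_p

lemma ps_pos (h : Admissible N p s β γ) : 0 < p * s := mul_pos h.p_pos h.s_pos

lemma one_le_N (h : Admissible N p s β γ) : 1 ≤ N := by
  have : (0 : ℝ) < N := h.ps_pos.trans h.ps_lt
  exact_mod_cast this

lemma γ_pos (h : Admissible N p s β γ) : 0 < γ := by
  have h1 : 0 < p * γ := by rw [h.p_mul_γ]; linarith [h.β_lt]
  exact pos_of_mul_pos_right h1 h.p_pos.le

lemma ps_lt_p (h : Admissible N p s β γ) : p * s < p := by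
  nlinarith [h.p_pos, h.s_lt_one]

end Admissible

/-! ### The integrands on `(1, ∞)`: identities, integrability and positivity of `Λ` -/

/-- The part `K(σ) (σ^γ - 1)^{p-1} σ^{β + p s - 1}` of the integrand of `Λ(γ)`, which comes from
the interval `(0, 1)`. -/
def innerIntegrand (N : ℕ) (p s β γ : ℝ) (x : Space N) (σ : ℝ) : ℝ :=
  sphereKernel N p s x σ * (σ ^ γ - 1) ^ (p - 1) * σ ^ (β + p * s - 1)

section Integrands

variable {N : ℕ} {p s β γ : ℝ} {x : Space N} {σ : ℝ}

lemma measurable_innerIntegrand : Measurable (innerIntegrand N p s β γ x) := by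
  have := measurable_sphereKernel N p s x
  unfold innerIntegrand
  fun_prop

lemma measurable_lambdaIntegrand : Measurable (lambdaIntegrand N p s β γ x) := by
  have := measurable_sphereKernel N p s x
  unfold lambdaIntegrand
  fun_prop

lemma rpow_sub_one_pos (hγ : 0 < γ) (hσ : 1 < σ) : 0 < σ ^ γ - 1 :=
  sub_pos.2 (Real.one_lt_rpow hσ hγ)

lemma innerIntegrand_nonneg (hγ : 0 < γ) (hσ : 1 < σ) : 0 ≤ innerIntegrand N p s β γ x σ := by
  have h1 := rpow_sub_one_pos hγ hσ
  have h2 := sphereKernel_nonneg N p s x σ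
  have h3 := zero_lt_one.trans hσ
  unfold innerIntegrand
  positivity

/-- The relation `pγ = N - ps - 2β` makes the two exponents in the integrand differ by exactly `γ`.
The extra factor `σ^γ - 1` yields positivity and one more order of vanishing at `1`. -/
lemma lambdaIntegrand_eq_mul (h : Admissible N p s β γ) (hσ : 1 < σ) :
    lambdaIntegrand N p s β γ x σ = innerIntegrand N p s β γ x σ * (σ ^ γ - 1) := by
  have h0 := zero_lt_one.trans hσ
  have : (N : ℝ) - 1 - β - γ * (p - 1) = γ + (β + p * s - 1) := by linarith [h.p_mul_γ]
  rw [lambdaIntegrand, innerIntegrand, this, Real.rpow_add h0]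
  ring

lemma lambdaIntegrand_eq (h : Admissible N p s β γ) (hσ : 1 < σ) :
    lambdaIntegrand N p s β γ x σ =
      σ ^ ((N : ℝ) - β - 1) * (1 - σ ^ (-γ)) ^ p * sphereKernel N p s x σ := by
  have h0 := zero_lt_one.trans hσ
  have h1 := rpow_sub_one_pos h.γ_pos hσ
  have h2 : 1 - σ ^ (-γ) = (σ ^ γ - 1) * σ ^ (-γ) := by
    rw [sub_mul, ← Real.rpow_add h0, add_neg_cancel, Real.rpow_zero, one_mul]
  have h3 : β + p * s - 1 = ((N : ℝ) - β - 1) + -γ * p := by linarith [h.p_mul_γ]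
  rw [lambdaIntegrand_eq_mul h hσ, innerIntegrand, h2, Real.mul_rpow h1.le (by positivity),
    ← Real.rpow_mul h0.le, h3, Real.rpow_add h0, Real.rpow_sub_one h1.ne']
  field_simp

lemma psi_eq_add (h : Admissible N p s β γ) (hσ : 1 < σ) :
    psi N p s β γ x σ = lambdaIntegrand N p s β γ x σ + innerIntegrand N p s β γ x σ := by
  have h0 := zero_lt_one.trans hσ
  have h1 := rpow_sub_one_pos h.γ_pos hσ
  have h2 : 1 - σ ^ (-γ) = (σ ^ γ - 1) * σ ^ (-γ) := by
    rw [sub_mul, ← Real.rpow_add h0, add_neg_cancel, Real.rpow_zero, one_mul]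
  have h4 : 0 < 1 - σ ^ (-γ) := by rw [h2]; positivity
  have h3 : (N : ℝ) - β - 1 = (β + p * s - 1) + (γ + γ * (p - 1)) := by linarith [h.p_mul_γ]
  rw [lambdaIntegrand_eq_mul h hσ, psi, innerIntegrand, abs_of_pos h4, ← Real.rpow_add_one h4.ne',
    show p - 2 + 1 = p - 1 by ring, h2, Real.mul_rpow h1.le (by positivity),
    ← Real.rpow_mul h0.le, h3, Real.rpow_add h0, Real.rpow_add h0 γ, neg_mul, Real.rpow_neg h0.le]
  have : σ ^ (γ * (p - 1)) ≠ 0 := (Real.rpow_pos_of_pos h0 _).ne'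
  field_simp
  ring

/-- The factor `σ⁻²` is the Jacobian of inversion, so this is `psi` on `(0,1)` folded onto `(1,∞)`.
It cancels the second summand in `psi_eq_add`, leaving the integrand of `Λ`. -/
lemma psi_inv (h : Admissible N p s β γ) (hx : ‖x‖ = 1) (hσ : 1 < σ) :
    (σ ^ 2)⁻¹ * psi N p s β γ x σ⁻¹ = -innerIntegrand N p s β γ x σ := by
  have h0 := zero_lt_one.trans hσ
  have h1 := rpow_sub_one_pos h.γ_pos hσ
  have h3 : β + p * s - 1 = ((N : ℝ) + p * s) - ((N : ℝ) - β - 1) - 2 := by ring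
  rw [psi, innerIntegrand, sphereKernel_inv hx h0, Real.inv_rpow h0.le, Real.rpow_neg h0.le,
    inv_inv, abs_sub_comm, abs_of_pos h1, show p - 1 = p - 2 + 1 by ring, Real.rpow_add_one h1.ne',
    Real.inv_rpow h0.le, h3, Real.rpow_sub h0 _ 2,
    Real.rpow_sub h0 ((N : ℝ) + p * s), Real.rpow_two]
  have : σ ^ ((N : ℝ) - β - 1) ≠ 0 := (Real.rpow_pos_of_pos h0 _).ne'
  field_simp
  ring

/-- Writing `σ^γ - 1 = σ^γ (1 - σ^(-γ))` and using `1 - σ^(-γ) ≤ γ log σ ≤ γ(σ - 1)` avoids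
distinguishing `γ < 1` from `γ ≥ 1`. -/
lemma rpow_sub_one_le (hγ : 0 < γ) (hσ : 1 < σ) (hσ₂ : σ ≤ 2) :
    σ ^ γ - 1 ≤ γ * 2 ^ γ * (σ - 1) := by
  have h0 := zero_lt_one.trans hσ
  have h1 : 1 - σ ^ (-γ) ≤ γ * (σ - 1) := by
    have h2 := Real.add_one_le_exp (Real.log σ * (-γ))
    rw [← Real.rpow_def_of_pos h0] at h2
    have h3 := Real.log_le_sub_one_of_pos h0
    nlinarith
  have h2 : σ ^ γ - 1 = σ ^ γ * (1 - σ ^ (-γ)) := by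
    rw [mul_sub, ← Real.rpow_add h0, add_neg_cancel, Real.rpow_zero, mul_one]
  have h4 : σ ^ γ ≤ 2 ^ γ := Real.rpow_le_rpow h0.le hσ₂ hγ.le
  have h5 : 0 < σ - 1 := sub_pos.2 hσ
  calc σ ^ γ - 1 = σ ^ γ * (1 - σ ^ (-γ)) := h2
    _ ≤ σ ^ γ * (γ * (σ - 1)) := by gcongr
    _ ≤ 2 ^ γ * (γ * (σ - 1)) := by gcongr
    _ = _ := by ring

theorem exists_innerIntegrand_le (h : Admissible N p s β γ) (hx : ‖x‖ = 1) :
    ∃ C : ℝ, 0 < C ∧ ∀ σ : ℝ, 1 < σ → σ ≤ 2 →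
      innerIntegrand N p s β γ x σ ≤ C * (σ - 1) ^ (p - p * s - 2) := by
  obtain ⟨C, hC, hK⟩ := exists_sphereKernel_le h.one_le_N h.ps_pos hx
  have hγ := h.γ_pos
  refine ⟨C * (γ * 2 ^ γ) ^ (p - 1) * 2 ^ (β + p * s), by positivity, fun σ hσ hσ₂ => ?_⟩
  have h0 := zero_lt_one.trans hσ
  have h1 := rpow_sub_one_pos h.γ_pos hσ
  have h5 : 0 < σ - 1 := sub_pos.2 hσ
  have hp1 : 0 < p - 1 := sub_pos.2 h.one_lt_p
  have hβ : 0 < β + p * s := by linarith [h.lt_β]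
  -- The exponent is raised by one first because `β + ps - 1` may be negative, whereas `β + ps` is
  -- positive.
  have e1 : σ ^ (β + p * s - 1) ≤ 2 ^ (β + p * s) :=
    (Real.rpow_le_rpow_of_exponent_le hσ.le (by linarith)).trans
      (Real.rpow_le_rpow h0.le hσ₂ hβ.le)
  have e2 : (σ ^ γ - 1) ^ (p - 1) ≤ (γ * 2 ^ γ) ^ (p - 1) * (σ - 1) ^ (p - 1) := by
    rw [← Real.mul_rpow (by positivity) h5.le]
    exact Real.rpow_le_rpow h1.le (rpow_sub_one_le hγ hσ hσ₂) hp1.le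
  calc innerIntegrand N p s β γ x σ
      ≤ (C * (σ - 1) ^ (-1 - p * s)) * ((γ * 2 ^ γ) ^ (p - 1) * (σ - 1) ^ (p - 1)) *
          2 ^ (β + p * s) := by
        unfold innerIntegrand
        have := (hK σ hσ).1
        gcongr
    _ = _ := by
        rw [show p - p * s - 2 = (-1 - p * s) + (p - 1) by ring, Real.rpow_add h5]
        ring

/-- Near `1` the integrand is `O((σ-1)^(p-ps-1))`, integrable because `s < 1`; at infinity it is
`O(σ^(-β-ps-1))`, integrable because `β > -ps`. -/
theorem integrableOn_lambdaIntegrand (h : Admissible N p s β γ) (hx : ‖x‖ = 1) :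
    IntegrableOn (lambdaIntegrand N p s β γ x) (Ioi 1) := by
  have hγ := h.γ_pos
  rw [← Ioc_union_Ioi_eq_Ioi one_le_two]
  refine IntegrableOn.union ?_ ?_
  · obtain ⟨C, hC, hB⟩ := exists_innerIntegrand_le h hx
    have hi : IntegrableOn (fun σ : ℝ => C * (γ * 2 ^ γ) * (σ - 1) ^ (p - p * s - 1))
        (Ioc 1 2) := by
      have := (intervalIntegral.intervalIntegrable_rpow' (a := 0) (b := 1) (r := p - p * s - 1)
        (by linarith [h.ps_lt_p])).comp_sub_right 1
      rw [zero_add, one_add_one_eq_two, intervalIntegrable_iff_integrableOn_Ioc_of_le one_le_two]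
        at this
      exact this.const_mul _
    refine hi.mono' measurable_lambdaIntegrand.aestronglyMeasurable ?_
    filter_upwards [ae_restrict_mem measurableSet_Ioc] with σ hσ
    have h1 := rpow_sub_one_pos h.γ_pos hσ.1
    have h5 : 0 < σ - 1 := sub_pos.2 hσ.1
    have h6 := innerIntegrand_nonneg (N := N) (p := p) (s := s) (β := β) (x := x) hγ hσ.1
    rw [lambdaIntegrand_eq_mul h hσ.1, Real.norm_of_nonneg (by positivity)]
    calc _ ≤ (C * (σ - 1) ^ (p - p * s - 2)) * (γ * 2 ^ γ * (σ - 1)) := by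
          have := hB σ hσ.1 hσ.2
          have := rpow_sub_one_le hγ hσ.1 hσ.2
          gcongr
      _ = _ := by
          rw [show p - p * s - 1 = (p - p * s - 2) + 1 by ring, Real.rpow_add_one h5.ne']
          ring
  · obtain ⟨C, hC, hK⟩ := exists_sphereKernel_le h.one_le_N h.ps_pos hx
    have hi : IntegrableOn (fun σ : ℝ => C * 2 ^ ((N : ℝ) + p * s) * σ ^ (-β - p * s - 1))
        (Ioi 2) :=
      (integrableOn_Ioi_rpow_of_lt (by linarith [h.lt_β]) two_pos).const_mul _
    refine hi.mono' measurable_lambdaIntegrand.aestronglyMeasurable ?_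
    filter_upwards [ae_restrict_mem measurableSet_Ioi] with σ hσ
    have hσ' : (2 : ℝ) < σ := hσ
    have hσ1 : 1 < σ := by linarith
    have h0 : 0 < σ := by linarith
    have h5 : 0 < σ - 1 := sub_pos.2 hσ1
    have hK0 := sphereKernel_nonneg N p s x σ
    have hNb : 0 < (N : ℝ) + p * s := by have := h.ps_pos; positivity
    have hle : σ ^ (-γ) ≤ 1 := Real.rpow_le_one_of_one_le_of_nonpos hσ1.le (by linarith)
    have hnn : 0 ≤ σ ^ (-γ) := by positivity
    have hnn' : 0 ≤ 1 - σ ^ (-γ) := by linarith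
    rw [lambdaIntegrand_eq h hσ1, Real.norm_of_nonneg (by positivity)]
    have e1 : (1 - σ ^ (-γ)) ^ p ≤ 1 :=
      Real.rpow_le_one (by linarith) (by linarith) h.p_pos.le
    have e2 : sphereKernel N p s x σ ≤ C * (2 ^ ((N : ℝ) + p * s) * σ ^ (-((N : ℝ) + p * s))) := by
      refine (hK σ hσ1).2.trans (mul_le_mul_of_nonneg_left ?_ hC.le)
      rw [← inv_inv (2 : ℝ), Real.inv_rpow (by norm_num), ← Real.rpow_neg (by norm_num),
        ← Real.mul_rpow (by norm_num) h0.le]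
      exact Real.rpow_le_rpow_of_nonpos (by positivity) (by linarith) (by linarith)
    calc _ ≤ σ ^ ((N : ℝ) - β - 1) * 1 *
          (C * (2 ^ ((N : ℝ) + p * s) * σ ^ (-((N : ℝ) + p * s)))) := by gcongr
      _ = _ := by
          rw [show -β - p * s - 1 = ((N : ℝ) - β - 1) + (-((N : ℝ) + p * s)) by ring,
            Real.rpow_add h0]
          ring

theorem Lam_pos (h : Admissible N p s β γ) (hx : ‖x‖ = 1) : 0 < Lam N p s β γ x := by
  have hpos : ∀ σ ∈ Ioi (1 : ℝ), 0 < lambdaIntegrand N p s β γ x σ := by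
    intro σ hσ
    have hσ' : (1 : ℝ) < σ := hσ
    have h1 := rpow_sub_one_pos h.γ_pos hσ'
    have h2 := sphereKernel_pos h.one_le_N h.ps_pos.le hx hσ'
    have h0 := zero_lt_one.trans hσ'
    rw [lambdaIntegrand_eq_mul h hσ', innerIntegrand]
    positivity
  rw [Lam, setIntegral_pos_iff_support_of_nonneg_ae
    ((ae_restrict_mem measurableSet_Ioi).mono fun σ hσ => (hpos σ hσ).le)
    (integrableOn_lambdaIntegrand h hx)]
  have : Function.support (lambdaIntegrand N p s β γ x) ∩ Ioi 1 = Ioi 1 :=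
    inter_eq_right.2 fun σ hσ => (hpos σ hσ).ne'
  simp [this]

/-- `Λ(γ)` in logarithmic coordinates, as an integral with values in `[0, ∞]`. -/
theorem lintegral_log_eq_Lam (h : Admissible N p s β γ) (hx : ‖x‖ = 1) :
    ∫⁻ v in Ioi (0 : ℝ), ENNReal.ofReal (Real.exp (((N : ℝ) - β) * v)) *
      (ENNReal.ofReal (1 - Real.exp (-γ * v)) ^ p *
        sphereLIntegral N (N + p * s) x (Real.exp v)) = ENNReal.ofReal (Lam N p s β γ x) := by
  have himg : Real.exp '' Ioi 0 = Ioi 1 := by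
    ext r
    constructor
    · rintro ⟨v, hv, rfl⟩
      exact Real.one_lt_exp_iff.2 hv
    · intro hr
      exact ⟨Real.log r, Real.log_pos hr, Real.exp_log (zero_lt_one.trans hr)⟩
  rw [Lam, ofReal_integral_eq_lintegral_ofReal (integrableOn_lambdaIntegrand h hx), ← himg,
    setLIntegral_exp _ _ measurableSet_Ioi]
  · refine setLIntegral_congr_fun measurableSet_Ioi fun v hv => ?_
    have hv1 : 1 < Real.exp v := Real.one_lt_exp_iff.2 hv
    have hle : Real.exp (-γ * v) ≤ 1 := by
      rw [Real.exp_le_one_iff]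
      have := mul_pos h.γ_pos (show 0 < v from hv)
      linarith
    have e1 : Real.exp v ^ (-γ) = Real.exp (-γ * v) := by rw [← Real.exp_mul, mul_comm]
    have e2 : Real.exp v * Real.exp v ^ ((N : ℝ) - β - 1) = Real.exp (((N : ℝ) - β) * v) := by
      rw [← Real.exp_mul, ← Real.exp_add]
      congr 1
      ring
    rw [lambdaIntegrand_eq h hv1, e1, ← ENNReal.ofReal_mul (Real.exp_pos _).le,
      ← ofReal_sphereKernel h.ps_pos.le hx hv1,
      ENNReal.ofReal_rpow_of_nonneg (by linarith) h.p_pos.le,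
      ← ENNReal.ofReal_mul (Real.rpow_nonneg (by linarith) _),
      ← ENNReal.ofReal_mul (Real.exp_pos _).le, ← e2]
    congr 1
    ring
  · filter_upwards [ae_restrict_mem measurableSet_Ioi] with σ hσ
    rw [lambdaIntegrand_eq_mul h hσ]
    exact mul_nonneg (innerIntegrand_nonneg h.γ_pos hσ) (rpow_sub_one_pos h.γ_pos hσ).le

/-! ### The principal value -/

/-- Beyond `a` the factor `σ^γ - 1` is at least `a^γ - 1 > 0`, so dividing the integrand of `Λ` by
it is harmless. The bound degenerates at `1`, which is why only a principal value is claimed for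
`psi`. -/
lemma integrableOn_innerIntegrand (h : Admissible N p s β γ) (hx : ‖x‖ = 1) {a : ℝ} (ha : 1 < a) :
    IntegrableOn (innerIntegrand N p s β γ x) (Ioi a) := by
  have hi := ((integrableOn_lambdaIntegrand h hx).mono_set (Ioi_subset_Ioi ha.le)).mul_const
    (a ^ γ - 1)⁻¹
  refine hi.mono' measurable_innerIntegrand.aestronglyMeasurable ?_
  filter_upwards [ae_restrict_mem measurableSet_Ioi] with σ hσ
  have hσ' : a < σ := hσ
  have h6 := innerIntegrand_nonneg (N := N) (p := p) (s := s) (β := β) (x := x) h.γ_pos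
    (ha.trans hσ')
  have h1 := rpow_sub_one_pos h.γ_pos ha
  rw [Real.norm_of_nonneg h6, lambdaIntegrand_eq_mul h (ha.trans hσ'), ← div_eq_mul_inv,
    le_div_iff₀ h1]
  have : a ^ γ ≤ σ ^ γ := Real.rpow_le_rpow (by linarith) hσ'.le h.γ_pos.le
  gcongr

lemma integrableOn_psi_Ioi (h : Admissible N p s β γ) (hx : ‖x‖ = 1) {a : ℝ} (ha : 1 < a) :
    IntegrableOn (psi N p s β γ x) (Ioi a) :=
  (((integrableOn_lambdaIntegrand h hx).mono_set (Ioi_subset_Ioi ha.le)).add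
    (integrableOn_innerIntegrand h hx ha)).congr_fun
      (fun _ hσ => (psi_eq_add h (ha.trans hσ)).symm) measurableSet_Ioi

lemma image_inv_Ioi {a : ℝ} (ha : 0 < a) : (fun σ : ℝ => σ⁻¹) '' Ioi a = Ioo 0 a⁻¹ := by
  rw [image_inv_eq_inv, inv_Ioi₀ ha]

lemma integrableOn_psi_Ioo (h : Admissible N p s β γ) (hx : ‖x‖ = 1) {a : ℝ} (ha : 1 < a) :
    IntegrableOn (psi N p s β γ x) (Ioo 0 a⁻¹) := by
  rw [← image_inv_Ioi (zero_lt_one.trans ha), integrableOn_image_iff_integrableOn_abs_deriv_smul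
    measurableSet_Ioi (fun σ hσ => (hasDerivAt_inv (by
      have : a < σ := hσ
      linarith)).hasDerivWithinAt) inv_injective.injOn]
  refine (integrableOn_innerIntegrand h hx ha).neg.congr_fun (fun σ hσ => ?_) measurableSet_Ioi
  have : (0 : ℝ) ≤ (σ ^ 2)⁻¹ := by positivity
  rw [abs_neg, abs_of_nonneg this, smul_eq_mul, psi_inv h hx (ha.trans hσ), Pi.neg_apply]

lemma integral_psi_Ioo (h : Admissible N p s β γ) (hx : ‖x‖ = 1) {a : ℝ} (ha : 1 < a) :
    ∫ σ in Ioo 0 a⁻¹, psi N p s β γ x σ = -∫ σ in Ioi a, innerIntegrand N p s β γ x σ := by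
  rw [← image_inv_Ioi (zero_lt_one.trans ha), integral_image_eq_integral_abs_deriv_smul
    measurableSet_Ioi (fun σ hσ => (hasDerivAt_inv (by
      have : a < σ := hσ
      linarith)).hasDerivWithinAt) inv_injective.injOn, ← integral_neg]
  refine setIntegral_congr_fun measurableSet_Ioi fun σ hσ => ?_
  have : (0 : ℝ) ≤ (σ ^ 2)⁻¹ := by positivity
  rw [abs_neg, abs_of_nonneg this, smul_eq_mul, psi_inv h hx (ha.trans hσ)]

lemma compl_ball_one_eq {ε : ℝ} (h0 : 0 < ε) :
    {σ : ℝ | 0 < σ ∧ ε < |σ - 1|} = Ioo 0 (1 - ε) ∪ Ioi (1 + ε) := by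
  ext σ
  simp only [mem_ofPred_eq, mem_union, mem_Ioo, mem_Ioi, lt_abs]
  constructor
  · rintro ⟨h1, h2 | h2⟩
    · right; linarith
    · left; constructor <;> linarith
  · rintro (⟨h1, h2⟩ | h2)
    · exact ⟨h1, Or.inr (by linarith)⟩
    · exact ⟨by linarith, Or.inl (by linarith)⟩

lemma one_lt_inv_one_sub {ε : ℝ} (h0 : 0 < ε) (h1 : ε < 1) : 1 < (1 - ε)⁻¹ :=
  (one_lt_inv₀ (by linarith)).2 (by linarith)

lemma one_add_le_inv_one_sub {ε : ℝ} (h1 : ε < 1) : 1 + ε ≤ (1 - ε)⁻¹ := by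
  rw [← one_div, le_div_iff₀ (by linarith)]
  nlinarith [sq_nonneg ε]

/-- After inversion the truncated integral equals that of `lambdaIntegrand` over `(1+ε, ∞)` plus
that of `innerIntegrand` over `(1+ε, (1-ε)⁻¹]`, the mismatch of the two cut-offs. The first tends to
`Λ`, the second to zero. -/
theorem hasPVIntegral_psi (h : Admissible N p s β γ) (hx : ‖x‖ = 1) :
    HasPVIntegral (psi N p s β γ x) (Lam N p s β γ x) := by
  have hint : ∀ ε : ℝ, 0 < ε → ε < 1 →
      IntegrableOn (psi N p s β γ x) (Ioo 0 (1 - ε)) := by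
    intro ε h0 h1
    have := integrableOn_psi_Ioo h hx (one_lt_inv_one_sub h0 h1)
    rwa [inv_inv] at this
  refine ⟨fun ε hε => ?_, ?_⟩
  · rw [compl_ball_one_eq hε]
    refine IntegrableOn.union ?_ (integrableOn_psi_Ioi h hx (by linarith))
    rcases lt_or_ge ε 1 with h1 | h1
    · exact hint ε hε h1
    · rw [Ioo_eq_empty (by linarith)]
      exact integrableOn_empty
  obtain ⟨C, hC, hB⟩ := exists_innerIntegrand_le h hx
  have hlim1 : Tendsto (fun ε : ℝ => ∫ σ in Ioi (1 + ε), lambdaIntegrand N p s β γ x σ) (𝓝[>] 0)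
      (𝓝 (Lam N p s β γ x)) := by
    have ht : Tendsto (fun ε : ℝ => 1 + ε) (𝓝[>] 0) (𝓝 1) := by
      have : Tendsto (fun ε : ℝ => 1 + ε) (𝓝 0) (𝓝 (1 + 0)) := by
        exact Continuous.tendsto (by fun_prop) 0
      rw [add_zero] at this
      exact this.mono_left nhdsWithin_le_nhds
    have := (aecover_Ioi_of_Ioi (μ := volume) ht).integral_tendsto_of_countably_generated
      (integrableOn_lambdaIntegrand h hx)
    refine this.congr' ?_
    filter_upwards [self_mem_nhdsWithin] with ε hε
    rw [Measure.restrict_restrict measurableSet_Ioi,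
      inter_eq_left.2 (Ioi_subset_Ioi (by linarith [show (0 : ℝ) < ε from hε]))]
  have hlim2 : Tendsto (fun ε : ℝ => ∫ σ in Ioc (1 + ε) (1 - ε)⁻¹, innerIntegrand N p s β γ x σ)
      (𝓝[>] 0) (𝓝 0) := by
    have hd : 0 < p - p * s := sub_pos.2 h.ps_lt_p
    have hz : Tendsto (fun ε : ℝ => C * 2 ^ (p - p * s) * 2 * ε ^ (p - p * s)) (𝓝[>] 0) (𝓝 0) := by
      have := (Real.continuousAt_rpow_const 0 (p - p * s) (Or.inr hd.le)).tendsto.const_mul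
        (C * 2 ^ (p - p * s) * 2)
      rw [Real.zero_rpow hd.ne', mul_zero] at this
      exact this.mono_left nhdsWithin_le_nhds
    refine squeeze_zero_norm' ?_ hz
    filter_upwards [Ioo_mem_nhdsGT (show (0 : ℝ) < 1 / 2 by norm_num)] with ε hε
    have hε0 := hε.1
    have h12 : (1 - ε)⁻¹ ≤ 1 + 2 * ε := by
      rw [inv_le_iff_one_le_mul₀ (by linarith [hε.2])]
      nlinarith [hε.2]
    -- The difference is `ε²/(1-ε)`, and `ε < 1/2`.
    have hlen : (1 - ε)⁻¹ - (1 + ε) ≤ 2 * ε ^ 2 := by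
      rw [sub_le_iff_le_add, inv_le_iff_one_le_mul₀ (by linarith [hε.2])]
      nlinarith [hε.2, sq_nonneg ε]
    have hbd : ∀ σ ∈ Ioc (1 + ε) (1 - ε)⁻¹,
        ‖innerIntegrand N p s β γ x σ‖ ≤ C * ((2 * ε) ^ (p - p * s) / ε ^ 2) := by
      intro σ hσ
      have hσ1 : 1 < σ := by linarith [hσ.1]
      have hσe : ε ≤ σ - 1 := by linarith [hσ.1]
      have hσp : 0 < σ - 1 := by linarith
      rw [Real.norm_of_nonneg (innerIntegrand_nonneg h.γ_pos hσ1)]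
      refine (hB σ hσ1 (by linarith [hσ.2, hε.2])).trans (mul_le_mul_of_nonneg_left ?_ hC.le)
      -- The sign of `p - ps - 2` is not known, so the power is split: the numerator is bounded by
      -- `σ - 1 ≤ 2ε`, the denominator by `ε ≤ σ - 1`.
      rw [Real.rpow_sub hσp, Real.rpow_two]
      gcongr
      linarith [hσ.2]
    refine (norm_setIntegral_le_of_norm_le_const (by simp) hbd).trans ?_
    rw [Real.volume_real_Ioc_of_le (one_add_le_inv_one_sub (by linarith [hε.2]))]
    calc _ ≤ C * ((2 * ε) ^ (p - p * s) / ε ^ 2) * (2 * ε ^ 2) := by gcongr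
      _ = _ := by
        rw [Real.mul_rpow zero_le_two hε0.le]
        field_simp
  have hlim := hlim1.add hlim2
  rw [add_zero] at hlim
  refine hlim.congr' ?_
  filter_upwards [Ioo_mem_nhdsGT (zero_lt_one' ℝ)] with ε hε
  have h1 : 1 < 1 + ε := by linarith [hε.1]
  have h2 := one_lt_inv_one_sub hε.1 hε.2
  rw [compl_ball_one_eq hε.1, setIntegral_union _ measurableSet_Ioi (hint ε hε.1 hε.2)
    (integrableOn_psi_Ioi h hx h1)]
  · have e1 := integral_psi_Ioo h hx h2
    rw [inv_inv] at e1
    rw [e1, setIntegral_congr_fun measurableSet_Ioi (fun σ hσ => psi_eq_add h (h1.trans hσ)),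
      integral_add ((integrableOn_lambdaIntegrand h hx).mono_set (Ioi_subset_Ioi h1.le))
        (integrableOn_innerIntegrand h hx h1),
      ← Ioc_union_Ioi_eq_Ioi (one_add_le_inv_one_sub hε.2),
      setIntegral_union (Ioc_disjoint_Ioi le_rfl) measurableSet_Ioi
        ((integrableOn_innerIntegrand h hx h1).mono_set Ioc_subset_Ioi_self)
        (integrableOn_innerIntegrand h hx h2)]
    -- The splitting of `Ioi (1 + ε)` also hit the integral of `lambdaIntegrand`; it is undone
    -- there.
    rw [Ioc_union_Ioi_eq_Ioi (one_add_le_inv_one_sub hε.2)]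
    ring
  · rw [disjoint_left]
    intro σ hσ hσ'
    have : 1 + ε < σ := hσ'
    linarith [hσ.2, hε.1]

end Integrands

/-! ### The energy and the Hardy term in logarithmic polar coordinates -/

section Energy

variable {N : ℕ} {p s β γ : ℝ} {φ : Space N → ℝ}

/-- The integrand of the energy. -/
def energyDensity (N : ℕ) (p s β : ℝ) (φ : Space N → ℝ) (x y : Space N) : ℝ≥0∞ :=
  ENNReal.ofReal (|φ x - φ y| ^ p / (‖x - y‖ ^ ((N : ℝ) + p * s) * ‖x‖ ^ β * ‖y‖ ^ β))

lemma energyDensity_comm (x y : Space N) :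
    energyDensity N p s β φ x y = energyDensity N p s β φ y x := by
  rw [energyDensity, energyDensity, abs_sub_comm, norm_sub_rev, mul_right_comm]

lemma measurable_energyDensity (hφ : Measurable φ) :
    Measurable fun z : Space N × Space N => energyDensity N p s β φ z.1 z.2 := by
  unfold energyDensity
  fun_prop

/-- The integrand of the energy, restricted to the pairs with `‖x‖ < ‖y‖`. -/
def halfDensity (N : ℕ) (p s β : ℝ) (φ : Space N → ℝ) (x : Space N) : Space N → ℝ≥0∞ :=
  {y : Space N | ‖x‖ < ‖y‖}.indicator (energyDensity N p s β φ x)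

lemma measurableSet_norm_lt (x : Space N) : MeasurableSet {y : Space N | ‖x‖ < ‖y‖} :=
  measurableSet_lt measurable_const measurable_norm

lemma measurable_halfDensity (hφ : Measurable φ) :
    Measurable (Function.uncurry (halfDensity N p s β φ)) :=
  (measurable_energyDensity hφ).indicator
    (measurableSet_lt measurable_fst.norm measurable_snd.norm)

lemma lintegral_halfDensity (x : Space N) : ∫⁻ y, halfDensity N p s β φ x y =
    ∫⁻ y in {y : Space N | ‖x‖ < ‖y‖}, energyDensity N p s β φ x y :=
  lintegral_indicator (measurableSet_norm_lt x) _

/-- The energy is twice the integral over the pairs with `‖x‖ < ‖y‖`. -/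
theorem energy_eq_two_mul (hN : 1 ≤ N) (hφ : Measurable φ) :
    energy N p s β φ =
      2 * ∫⁻ x, ∫⁻ y in {y : Space N | ‖x‖ < ‖y‖}, energyDensity N p s β φ x y := by
  have := nontrivial_space hN
  have hGm := measurable_halfDensity (p := p) (s := s) (β := β) hφ
  simp only [← lintegral_halfDensity]
  generalize hG : halfDensity N p s β φ = G at hGm
  have hsplit : ∀ x, ∫⁻ y, energyDensity N p s β φ x y = (∫⁻ y, G x y) + ∫⁻ y, G y x := by
    intro x
    have hx : Measurable (G x) := hGm.of_uncurry_left
    rw [← lintegral_add_left hx]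
    refine lintegral_congr_ae ?_
    have h0 : ∀ᵐ y : Space N, y ∉ Metric.sphere (0 : Space N) ‖x‖ :=
      measure_eq_zero_iff_ae_notMem.1 (Measure.addHaar_sphere volume 0 ‖x‖)
    filter_upwards [h0] with y hy
    simp only [mem_sphere_zero_iff_norm] at hy
    simp only [← hG, halfDensity, indicator, mem_ofPred_eq]
    rcases lt_or_gt_of_ne hy with h | h
    · rw [if_neg h.not_gt, if_pos h, zero_add, energyDensity_comm]
    · rw [if_pos h, if_neg h.not_gt, add_zero]
  calc energy N p s β φ = ∫⁻ x, ((∫⁻ y, G x y) + ∫⁻ y, G y x) := lintegral_congr hsplit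
    _ = (∫⁻ x, ∫⁻ y, G x y) + ∫⁻ x, ∫⁻ y, G y x :=
        lintegral_add_left (Measurable.lintegral_prod_right' hGm) _
    _ = (∫⁻ x, ∫⁻ y, G x y) + ∫⁻ x, ∫⁻ y, G x y := by
        congr 1
        exact lintegral_lintegral_swap (f := fun x y => G y x)
          (hGm.comp measurable_swap).aemeasurable
    _ = _ := by
        rw [← two_mul]

/-- The function `φ` in logarithmic polar coordinates, multiplied by `‖x‖ ^ γ`. -/
def logProfile (N : ℕ) (γ : ℝ) (φ : Space N → ℝ) (θ : USphere N) (t : ℝ) : ℝ :=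
  Real.exp (γ * t) * φ (Real.exp t • (θ : Space N))

/-- The energy of the pairs of points with `‖y‖ = e ^ v ‖x‖`, in terms of the logarithmic
profile. -/
def sliceEnergy (N : ℕ) (p a γ : ℝ) (F : USphere N → ℝ → ℝ) (v : ℝ) : ℝ≥0∞ :=
  ∫⁻ θ, ∫⁻ η, ∫⁻ t, ENNReal.ofReal (1 / ‖(θ : Space N) - Real.exp v • (η : Space N)‖ ^ a) *
    ENNReal.ofReal |F θ t - Real.exp (-γ * v) * F η (t + v)| ^ p
    ∂volume ∂sphereMeasure N ∂sphereMeasure N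

/-- The volume factor `e^(Nt)` and the weight `e^(-(ps+2β)t)` combine to `e^(pγt)`, exactly what the
factor `e^(γt)` in the profile absorbs. -/
theorem hardyTerm_eq (h : Admissible N p s β γ) (hφ : Measurable φ) :
    hardyTerm N p s β φ =
      ∫⁻ θ, ∫⁻ t, ENNReal.ofReal |logProfile N γ φ θ t| ^ p ∂volume ∂sphereMeasure N := by
  rw [hardyTerm, lintegral_polar_log h.one_le_N (by fun_prop)]
  refine lintegral_congr fun θ => lintegral_congr fun t => ?_
  rw [ENNReal.ofReal_rpow_of_nonneg (abs_nonneg _) h.p_pos.le,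
    ← ENNReal.ofReal_mul (Real.exp_pos _).le]
  congr 1
  rw [logProfile, abs_mul, Real.abs_exp, Real.mul_rpow (Real.exp_pos _).le (abs_nonneg _),
    norm_smul, norm_coe_sphere, mul_one, Real.norm_eq_abs, Real.abs_exp, ← Real.exp_mul,
    ← Real.exp_mul, div_eq_mul_inv, ← Real.exp_neg, mul_left_comm, ← Real.exp_add, mul_comm]
  congr 2
  linear_combination t * (-h.p_mul_γ)

/-- By homogeneity all powers of `e^t` cancel against the `p`-th power of the profile; only the
ratio `e^v` of the two norms survives in the weight and the kernel. -/
lemma energyDensity_polar (h : Admissible N p s β γ) (θ η : USphere N) (t v : ℝ) :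
    ENNReal.ofReal (Real.exp (N * t)) * (ENNReal.ofReal (Real.exp (N * (t + v))) *
      energyDensity N p s β φ (Real.exp t • (θ : Space N)) (Real.exp (t + v) • (η : Space N))) =
    ENNReal.ofReal (Real.exp (((N : ℝ) - β) * v)) *
      (ENNReal.ofReal (1 / ‖(θ : Space N) - Real.exp v • (η : Space N)‖ ^ ((N : ℝ) + p * s)) *
      ENNReal.ofReal |logProfile N γ φ θ t - Real.exp (-γ * v) * logProfile N γ φ η (t + v)| ^ p)
      := by
  have e1 : logProfile N γ φ θ t - Real.exp (-γ * v) * logProfile N γ φ η (t + v) =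
      Real.exp (γ * t) *
        (φ (Real.exp t • (θ : Space N)) - φ (Real.exp (t + v) • (η : Space N))) := by
    rw [logProfile, logProfile, ← mul_assoc, ← Real.exp_add,
      show -γ * v + γ * (t + v) = γ * t by ring]
    ring
  have e2 : Real.exp t • (θ : Space N) - Real.exp (t + v) • (η : Space N) =
      Real.exp t • ((θ : Space N) - Real.exp v • (η : Space N)) := by
    rw [smul_sub, smul_smul, Real.exp_add]
  rw [energyDensity, e1, e2, ENNReal.ofReal_rpow_of_nonneg (abs_nonneg _) h.p_pos.le,
    ← ENNReal.ofReal_mul (Real.exp_pos _).le, ← ENNReal.ofReal_mul (Real.exp_pos _).le,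
    ← ENNReal.ofReal_mul (by positivity), ← ENNReal.ofReal_mul (Real.exp_pos _).le]
  congr 1
  rw [abs_mul, Real.abs_exp, Real.mul_rpow (Real.exp_pos _).le (abs_nonneg _)]
  simp only [norm_smul, norm_coe_sphere, mul_one, Real.norm_eq_abs, Real.abs_exp]
  rw [Real.mul_rpow (Real.exp_pos _).le (norm_nonneg _), ← Real.exp_mul, ← Real.exp_mul,
    ← Real.exp_mul, ← Real.exp_mul]
  have e3 : γ * t * p = N * t + N * (t + v) - t * (N + p * s) - t * β - (t + v) * β -
      ((N : ℝ) - β) * v := by linear_combination t * h.p_mul_γ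
  generalize |φ (Real.exp t • (θ : Space N)) - φ (Real.exp (t + v) • (η : Space N))| ^ p = A
  generalize ‖(θ : Space N) - Real.exp v • (η : Space N)‖ ^ ((N : ℝ) + p * s) = B
  rw [e3, Real.exp_sub, Real.exp_sub, Real.exp_sub, Real.exp_sub, Real.exp_add]
  field_simp

theorem energy_eq_lintegral_slice (h : Admissible N p s β γ) (hφ : Measurable φ) :
    energy N p s β φ = 2 * ∫⁻ v in Ioi (0 : ℝ), ENNReal.ofReal (Real.exp (((N : ℝ) - β) * v)) *
      sliceEnergy N p (N + p * s) γ (logProfile N γ φ) v := by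
  rw [energy_eq_two_mul h.one_le_N hφ]
  congr 1
  set T : USphere N → USphere N → ℝ → ℝ → ℝ≥0∞ := fun θ η t v =>
    ENNReal.ofReal (1 / ‖(θ : Space N) - Real.exp v • (η : Space N)‖ ^ ((N : ℝ) + p * s)) *
      ENNReal.ofReal |logProfile N γ φ θ t - Real.exp (-γ * v) * logProfile N γ φ η (t + v)| ^ p
    with hT
  set W : ℝ → ℝ≥0∞ := fun v => ENNReal.ofReal (Real.exp (((N : ℝ) - β) * v)) with hW
  have hTm : Measurable fun z : USphere N × USphere N × ℝ × ℝ =>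
      W z.2.2.2 * T z.1 z.2.1 z.2.2.1 z.2.2.2 := by
    simp only [hT, hW, logProfile]
    fun_prop
  have hG : Measurable fun x : Space N => ∫⁻ y, halfDensity N p s β φ x y :=
    Measurable.lintegral_prod_right' (measurable_halfDensity hφ)
  have hinner : ∀ (θ : USphere N) (t : ℝ), ENNReal.ofReal (Real.exp (N * t)) *
      ∫⁻ y, halfDensity N p s β φ (Real.exp t • (θ : Space N)) y =
      ∫⁻ η, ∫⁻ v in Ioi (0 : ℝ), W v * T θ η t v ∂volume ∂sphereMeasure N := by
    intro θ t
    rw [lintegral_polar_log h.one_le_N (measurable_halfDensity hφ).of_uncurry_left,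
      ← lintegral_const_mul' _ _ ENNReal.ofReal_ne_top]
    refine lintegral_congr fun η => ?_
    -- Translating the logarithmic radius of `y` by `t` turns the condition `‖x‖ < ‖y‖` into `v >
    -- 0`. What remains after this is Tonelli, moving `v` outermost.
    rw [← lintegral_const_mul' _ _ ENNReal.ofReal_ne_top, ← lintegral_indicator measurableSet_Ioi,
      ← lintegral_add_left_eq_self _ t]
    refine lintegral_congr fun v => ?_
    have hiff : Real.exp (t + v) • (η : Space N) ∈
        {y : Space N | ‖Real.exp t • (θ : Space N)‖ < ‖y‖} ↔ v ∈ Ioi (0 : ℝ) := by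
      simp [norm_smul]
    by_cases hv : v ∈ Ioi (0 : ℝ)
    · rw [indicator_of_mem hv, halfDensity, indicator_of_mem (hiff.2 hv)]
      exact energyDensity_polar h θ η t v
    · rw [indicator_of_notMem hv, halfDensity, indicator_of_notMem (fun h' => hv (hiff.1 h')),
        mul_zero, mul_zero]
  simp only [← lintegral_halfDensity]
  rw [lintegral_polar_log h.one_le_N hG]
  simp only [hinner]
  have hslice : ∀ v, W v * sliceEnergy N p (N + p * s) γ (logProfile N γ φ) v =
      ∫⁻ θ, ∫⁻ η, ∫⁻ t, W v * T θ η t v ∂volume ∂sphereMeasure N ∂sphereMeasure N := by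
    intro v
    rw [sliceEnergy, ← lintegral_const_mul' _ _ ENNReal.ofReal_ne_top]
    refine lintegral_congr fun θ => ?_
    rw [← lintegral_const_mul' _ _ ENNReal.ofReal_ne_top]
    refine lintegral_congr fun η => ?_
    rw [← lintegral_const_mul' _ _ ENNReal.ofReal_ne_top]
  simp only [show ∀ v, ENNReal.ofReal (Real.exp (((N : ℝ) - β) * v)) = W v from fun _ => rfl,
    hslice]
  have m4 : ∀ θ, Measurable fun z : USphere N × ℝ × ℝ => W z.2.2 * T θ z.1 z.2.1 z.2.2 :=
    fun θ => hTm.comp (by fun_prop : Measurable fun z : USphere N × ℝ × ℝ => (θ, z))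
  have m3 : ∀ θ η, Measurable fun z : ℝ × ℝ => W z.2 * T θ η z.1 z.2 :=
    fun θ η => hTm.comp (by fun_prop : Measurable fun z : ℝ × ℝ => (θ, η, z))
  calc _ = ∫⁻ θ, ∫⁻ η, ∫⁻ t, ∫⁻ v in Ioi (0 : ℝ), W v * T θ η t v
        ∂volume ∂volume ∂sphereMeasure N ∂sphereMeasure N := by
        refine lintegral_congr fun θ => lintegral_lintegral_swap (Measurable.aemeasurable ?_)
        exact Measurable.lintegral_prod_right' (f := fun z : (ℝ × USphere N) × ℝ =>
          W z.2 * T θ z.1.2 z.1.1 z.2) ((m4 θ).comp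
            (by fun_prop : Measurable fun z : (ℝ × USphere N) × ℝ => (z.1.2, z.1.1, z.2)))
    _ = ∫⁻ θ, ∫⁻ η, ∫⁻ v in Ioi (0 : ℝ), ∫⁻ t, W v * T θ η t v
        ∂volume ∂volume ∂sphereMeasure N ∂sphereMeasure N := by
        refine lintegral_congr fun θ => lintegral_congr fun η => lintegral_lintegral_swap ?_
        exact (m3 θ η).aemeasurable
    _ = ∫⁻ θ, ∫⁻ v in Ioi (0 : ℝ), ∫⁻ η, ∫⁻ t, W v * T θ η t v
        ∂volume ∂sphereMeasure N ∂volume ∂sphereMeasure N := by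
        refine lintegral_congr fun θ => lintegral_lintegral_swap (Measurable.aemeasurable ?_)
        exact Measurable.lintegral_prod_right' (f := fun z : (USphere N × ℝ) × ℝ =>
          W z.1.2 * T θ z.1.1 z.2 z.1.2) ((m4 θ).comp
            (by fun_prop : Measurable fun z : (USphere N × ℝ) × ℝ => (z.1.1, z.2, z.1.2)))
    _ = _ := by
        refine lintegral_lintegral_swap (Measurable.aemeasurable ?_)
        refine Measurable.lintegral_prod_right' (f := fun z : (USphere N × ℝ) × USphere N =>
          ∫⁻ t, W z.1.2 * T z.1.1 z.2 t z.1.2) ?_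
        exact Measurable.lintegral_prod_right' (f := fun z : ((USphere N × ℝ) × USphere N) × ℝ =>
          W z.1.1.2 * T z.1.1.1 z.1.2 z.2 z.1.1.2) (hTm.comp
            (by fun_prop : Measurable fun z : ((USphere N × ℝ) × USphere N) × ℝ =>
              (z.1.1.1, z.1.2, z.2, z.1.1.2)))

end Energy

/-! ### Slices of fixed ratio `‖y‖ / ‖x‖ = e^v` -/

section Slices

variable {N : ℕ} {p a γ : ℝ} {x : Space N}

/-- The kernel `‖θ - e ^ v η‖ ^ (-a)` as a measure on pairs of directions and logarithmic radii. -/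
def sliceMeasure (N : ℕ) (a v : ℝ) : Measure (USphere N × USphere N × ℝ) :=
  ((sphereMeasure N).prod ((sphereMeasure N).prod volume)).withDensity fun z =>
    ENNReal.ofReal (1 / ‖(z.1 : Space N) - Real.exp v • (z.2.1 : Space N)‖ ^ a)

lemma lintegral_sliceMeasure (v : ℝ) {g : USphere N × USphere N × ℝ → ℝ≥0∞} (hg : Measurable g) :
    ∫⁻ z, g z ∂sliceMeasure N a v = ∫⁻ θ, ∫⁻ η, ∫⁻ t,
      ENNReal.ofReal (1 / ‖(θ : Space N) - Real.exp v • (η : Space N)‖ ^ a) * g (θ, η, t)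
      ∂volume ∂sphereMeasure N ∂sphereMeasure N := by
  have hk : Measurable fun z : USphere N × USphere N × ℝ =>
      ENNReal.ofReal (1 / ‖(z.1 : Space N) - Real.exp v • (z.2.1 : Space N)‖ ^ a) := by fun_prop
  rw [sliceMeasure, lintegral_withDensity_eq_lintegral_mul _ hk hg,
    lintegral_prod _ (hk.mul hg).aemeasurable]
  refine lintegral_congr fun θ => ?_
  exact lintegral_prod _ ((hk.mul hg).comp measurable_prodMk_left).aemeasurable

/-- Integrating the kernel over `η` gives `K(e^v)` whatever `θ` is, by rotation invariance: the
first marginal of the slice measure is `K(e^v) dθ dt`. -/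
lemma lintegral_sliceMeasure_left (hx : ‖x‖ = 1) (v : ℝ) {f : USphere N → ℝ → ℝ≥0∞}
    (hf : Measurable (Function.uncurry f)) :
    ∫⁻ z, f z.1 z.2.2 ∂sliceMeasure N a v =
      sphereLIntegral N a x (Real.exp v) * ∫⁻ θ, ∫⁻ t, f θ t ∂volume ∂sphereMeasure N := by
  have hg : Measurable fun z : USphere N × USphere N × ℝ => f z.1 z.2.2 :=
    hf.comp (by fun_prop : Measurable fun z : USphere N × USphere N × ℝ => (z.1, z.2.2))
  have hF : Measurable fun θ => ∫⁻ t, f θ t := Measurable.lintegral_prod_right' hf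
  rw [lintegral_sliceMeasure v hg, ← lintegral_const_mul _ hF]
  refine lintegral_congr fun θ => ?_
  rw [sphereLIntegral_congr a (hx.trans (norm_coe_sphere θ).symm), sphereLIntegral,
    ← lintegral_mul_const _ (by fun_prop)]
  exact lintegral_congr fun η => lintegral_const_mul _ hf.of_uncurry_left

/-- The marginal in `(η, t + v)` is the same measure, because the kernel is symmetric in `θ` and `η`
and `dt` is translation invariant. -/
lemma lintegral_sliceMeasure_right (hx : ‖x‖ = 1) (v : ℝ) {f : USphere N → ℝ → ℝ≥0∞}
    (hf : Measurable (Function.uncurry f)) :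
    ∫⁻ z, f z.2.1 (z.2.2 + v) ∂sliceMeasure N a v =
      sphereLIntegral N a x (Real.exp v) * ∫⁻ θ, ∫⁻ t, f θ t ∂volume ∂sphereMeasure N := by
  have hg : Measurable fun z : USphere N × USphere N × ℝ => f z.2.1 (z.2.2 + v) :=
    hf.comp (by fun_prop : Measurable fun z : USphere N × USphere N × ℝ => (z.2.1, z.2.2 + v))
  have hF : Measurable fun θ => ∫⁻ t, f θ t := Measurable.lintegral_prod_right' hf
  rw [lintegral_sliceMeasure v hg, ← lintegral_const_mul _ hF]
  have : ∀ θ η : USphere N, ∫⁻ t, ENNReal.ofReal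
      (1 / ‖(θ : Space N) - Real.exp v • (η : Space N)‖ ^ a) * f η (t + v) =
      ENNReal.ofReal (1 / ‖(η : Space N) - Real.exp v • (θ : Space N)‖ ^ a) * ∫⁻ t, f η t := by
    intro θ η
    rw [norm_sub_smul_comm (by simp : ‖(θ : Space N)‖ = ‖(η : Space N)‖),
      lintegral_const_mul' _ _ ENNReal.ofReal_ne_top, lintegral_add_right_eq_self (f η) v]
  simp only [this]
  rw [lintegral_lintegral_swap (by fun_prop)]
  refine lintegral_congr fun η => ?_
  rw [sphereLIntegral_congr a (hx.trans (norm_coe_sphere η).symm), sphereLIntegral,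
    ← lintegral_mul_const _ (by fun_prop)]

lemma sliceEnergy_eq (F : USphere N → ℝ → ℝ) (hF : Measurable (Function.uncurry F)) (v : ℝ) :
    sliceEnergy N p a γ F v = ∫⁻ z, ENNReal.ofReal
      |F z.1 z.2.2 - Real.exp (-γ * v) * F z.2.1 (z.2.2 + v)| ^ p ∂sliceMeasure N a v := by
  have h1 : Measurable fun z : USphere N × USphere N × ℝ => F z.1 z.2.2 :=
    hF.comp (by fun_prop : Measurable fun z : USphere N × USphere N × ℝ => (z.1, z.2.2))
  have h2 : Measurable fun z : USphere N × USphere N × ℝ => F z.2.1 (z.2.2 + v) :=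
    hF.comp (by fun_prop : Measurable fun z : USphere N × USphere N × ℝ => (z.2.1, z.2.2 + v))
  rw [lintegral_sliceMeasure v (by fun_prop), sliceEnergy]

/-- The reverse triangle inequality on a slice. -/
theorem le_sliceEnergy (hp : 1 ≤ p) (hγ : 0 < γ) (hx : ‖x‖ = 1) {F : USphere N → ℝ → ℝ}
    (hF : Measurable (Function.uncurry F)) {v : ℝ} (hv : 0 < v)
    (hK : sphereLIntegral N a x (Real.exp v) ≠ ⊤)
    (hD : ∫⁻ θ, ∫⁻ t, ENNReal.ofReal |F θ t| ^ p ∂volume ∂sphereMeasure N ≠ ⊤) :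
    ENNReal.ofReal (1 - Real.exp (-γ * v)) ^ p * sphereLIntegral N a x (Real.exp v) *
      ∫⁻ θ, ∫⁻ t, ENNReal.ofReal |F θ t| ^ p ∂volume ∂sphereMeasure N ≤
      sliceEnergy N p a γ F v := by
  have hp0 : 0 < p := zero_lt_one.trans_le hp
  set c := Real.exp (-γ * v) with hc
  have hc0 : 0 ≤ c := (Real.exp_pos _).le
  have hc1 : c ≤ 1 := by
    rw [hc, Real.exp_le_one_iff]
    have := mul_pos hγ hv
    linarith
  set D := ∫⁻ θ, ∫⁻ t, ENNReal.ofReal |F θ t| ^ p ∂volume ∂sphereMeasure N with hDdef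
  set K := sphereLIntegral N a x (Real.exp v) with hKdef
  have h1 : Measurable fun z : USphere N × USphere N × ℝ => F z.1 z.2.2 :=
    hF.comp (by fun_prop : Measurable fun z : USphere N × USphere N × ℝ => (z.1, z.2.2))
  have h2 : Measurable fun z : USphere N × USphere N × ℝ => F z.2.1 (z.2.2 + v) :=
    hF.comp (by fun_prop : Measurable fun z : USphere N × USphere N × ℝ => (z.2.1, z.2.2 + v))
  have hfm : Measurable (Function.uncurry fun θ t => ENNReal.ofReal |F θ t| ^ p) := by
    change Measurable fun z : USphere N × ℝ => ENNReal.ofReal |Function.uncurry F z| ^ p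
    fun_prop
  have hleft : ∫⁻ z, ENNReal.ofReal |F z.1 z.2.2| ^ p ∂sliceMeasure N a v = K * D :=
    lintegral_sliceMeasure_left hx v hfm
  have hright : ∫⁻ z, (ENNReal.ofReal c * ENNReal.ofReal |F z.2.1 (z.2.2 + v)|) ^ p
      ∂sliceMeasure N a v = ENNReal.ofReal c ^ p * (K * D) := by
    simp only [ENNReal.mul_rpow_of_nonneg _ _ hp0.le]
    rw [lintegral_const_mul' _ _ (by finiteness)]
    congr 1
    exact lintegral_sliceMeasure_right hx v hfm
  have hmink := ENNReal.lintegral_Lp_add_le (μ := sliceMeasure N a v) (p := p)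
    (f := fun z => ENNReal.ofReal |F z.1 z.2.2 - c * F z.2.1 (z.2.2 + v)|)
    (g := fun z => ENNReal.ofReal c * ENNReal.ofReal |F z.2.1 (z.2.2 + v)|)
    (by fun_prop) (by fun_prop) hp
  have hle : ∫⁻ z, ENNReal.ofReal |F z.1 z.2.2| ^ p ∂sliceMeasure N a v ≤
      ∫⁻ z, ((fun z : USphere N × USphere N × ℝ =>
          ENNReal.ofReal |F z.1 z.2.2 - c * F z.2.1 (z.2.2 + v)|) +
        fun z : USphere N × USphere N × ℝ =>
          ENNReal.ofReal c * ENNReal.ofReal |F z.2.1 (z.2.2 + v)|) z ^ p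
        ∂sliceMeasure N a v := by
    refine lintegral_mono fun z => ENNReal.rpow_le_rpow ?_ hp0.le
    rw [Pi.add_apply, ← ENNReal.ofReal_mul hc0, ← ENNReal.ofReal_add (abs_nonneg _)
      (by positivity)]
    refine ENNReal.ofReal_le_ofReal ?_
    have := abs_add_le (F z.1 z.2.2 - c * F z.2.1 (z.2.2 + v)) (c * F z.2.1 (z.2.2 + v))
    rwa [sub_add_cancel, abs_mul, abs_of_nonneg hc0] at this
  rw [hleft] at hle
  have hle2 := (ENNReal.rpow_le_rpow hle (by positivity : 0 ≤ 1 / p)).trans hmink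
  rw [hright, ← sliceEnergy_eq F hF,
    ENNReal.mul_rpow_of_nonneg (ENNReal.ofReal c ^ p) (K * D) (by positivity : 0 ≤ 1 / p),
    ← ENNReal.rpow_mul, mul_one_div_cancel hp0.ne', ENNReal.rpow_one] at hle2
  have hA : (K * D) ^ (1 / p) ≠ ⊤ :=
    ENNReal.rpow_ne_top_of_nonneg (by positivity) (ENNReal.mul_ne_top hK hD)
  -- Minkowski for `F = (F - cF_v) + cF_v` reads `‖F‖ ≤ ‖F - cF_v‖ + c‖F‖`. Splitting the left side
  -- as `(1-c)‖F‖ + c‖F‖` lets the finite term `c‖F‖` be cancelled; finiteness of `K` and `D` is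
  -- needed for this.
  have hsum : (K * D) ^ (1 / p) = ENNReal.ofReal (1 - c) * (K * D) ^ (1 / p) +
      ENNReal.ofReal c * (K * D) ^ (1 / p) := by
    rw [← add_mul, ← ENNReal.ofReal_add (by linarith) hc0, sub_add_cancel, ENNReal.ofReal_one,
      one_mul]
  nth_rewrite 1 [hsum] at hle2
  have hle3 := (ENNReal.add_le_add_iff_right (ENNReal.mul_ne_top ENNReal.ofReal_ne_top hA)).1 hle2
  have hle4 := ENNReal.rpow_le_rpow hle3 hp0.le
  rwa [ENNReal.mul_rpow_of_nonneg _ _ hp0.le, ← ENNReal.rpow_mul, ← ENNReal.rpow_mul,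
    one_div_mul_cancel hp0.ne', ENNReal.rpow_one, ENNReal.rpow_one, ← mul_assoc] at hle4

/-- The energy of a slice of a radial profile. -/
theorem sliceEnergy_radial (hx : ‖x‖ = 1) {g : ℝ → ℝ} (hg : Measurable g) (v : ℝ) :
    sliceEnergy N p a γ (fun _ => g) v = sphereLIntegral N a x (Real.exp v) *
      (sphereMeasure N univ *
        ∫⁻ t, ENNReal.ofReal |g t - Real.exp (-γ * v) * g (t + v)| ^ p) := by
  rw [sliceEnergy_eq (fun _ => g) (hg.comp measurable_snd)]
  refine (lintegral_sliceMeasure_left hx v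
    (f := fun _ t => ENNReal.ofReal |g t - Real.exp (-γ * v) * g (t + v)| ^ p) ?_).trans ?_
  · change Measurable fun z : USphere N × ℝ =>
      ENNReal.ofReal |g z.2 - Real.exp (-γ * v) * g (z.2 + v)| ^ p
    fun_prop
  · rw [lintegral_const, mul_comm (sphereMeasure N univ)]

end Slices

/-! ### The Hardy inequality with constant `2Λ` -/

section LowerBound

variable {N : ℕ} {p s β γ : ℝ} {φ : Space N → ℝ} {x : Space N}

lemma measurable_logProfile (hφ : Measurable φ) :
    Measurable (Function.uncurry (logProfile N γ φ)) := by
  change Measurable fun z : USphere N × ℝ =>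
    Real.exp (γ * z.2) * φ (Real.exp z.2 • (z.1 : Space N))
  fun_prop

/-- The weighted fractional Hardy inequality. -/
theorem Lam_mul_hardyTerm_le_energy (h : Admissible N p s β γ) (hx : ‖x‖ = 1) (hφ : Measurable φ)
    (hD : hardyTerm N p s β φ ≠ ⊤) :
    ENNReal.ofReal (2 * Lam N p s β γ x) * hardyTerm N p s β φ ≤ energy N p s β φ := by
  rw [energy_eq_lintegral_slice h hφ, ENNReal.ofReal_mul zero_le_two, ENNReal.ofReal_ofNat,
    mul_assoc]
  refine mul_le_mul_right ?_ _
  rw [← lintegral_log_eq_Lam h hx, ← lintegral_mul_const' _ _ hD]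
  refine setLIntegral_mono' measurableSet_Ioi fun v hv => ?_
  rw [mul_assoc]
  refine mul_le_mul_right ?_ _
  rw [hardyTerm_eq h hφ] at hD ⊢
  have hps := h.ps_pos
  exact le_sliceEnergy h.one_lt_p.le h.γ_pos hx (measurable_logProfile hφ) hv
    (sphereLIntegral_ne_top (by positivity) hx (Real.one_lt_exp_iff.2 hv)) hD

end LowerBound

/-! ### Sharpness: slowly varying radial profiles -/

section UpperBound

variable {N : ℕ} {p s β γ : ℝ} {φ : Space N → ℝ} {x : Space N}

/-- The difference is at most `Lv/R` and lives on two intervals of total length at most `8R`,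
whatever `v` is, while `g = 1` on an interval of length `2R`; hence the factor `4`. -/
lemma lintegral_sub_shift_le (hp : 0 < p) {g : ℝ → ℝ} {L R : ℝ} (hR : 0 < R)
    (hlip : ∀ t u, |g t - g u| ≤ L / R * |t - u|) (hsupp : ∀ t, 2 * R < |t| → g t = 0)
    (hone : ∀ t, |t| ≤ R → g t = 1) {v : ℝ} (hv : 0 ≤ v) :
    ∫⁻ t, ENNReal.ofReal |g t - g (t + v)| ^ p ≤
      ENNReal.ofReal (L / R * v) ^ p * (4 * ∫⁻ t, ENNReal.ofReal |g t| ^ p) := by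
  have h1 : ENNReal.ofReal (2 * R) ≤ ∫⁻ t, ENNReal.ofReal |g t| ^ p := by
    calc ENNReal.ofReal (2 * R) = ∫⁻ t in Icc (-R) R, 1 := by
          rw [setLIntegral_one, Real.volume_Icc]
          congr 1
          ring
      _ ≤ ∫⁻ t in Icc (-R) R, ENNReal.ofReal |g t| ^ p := by
          refine setLIntegral_mono' measurableSet_Icc fun t ht => ?_
          rw [hone t (abs_le.2 ht)]
          simp
      _ ≤ _ := setLIntegral_le_lintegral _ _
  set S : Set ℝ := Icc (-(2 * R)) (2 * R) ∪ Icc (-(2 * R) - v) (2 * R - v) with hS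
  have hSm : MeasurableSet S := measurableSet_Icc.union measurableSet_Icc
  have hvol : volume S ≤ 4 * ENNReal.ofReal (2 * R) := by
    refine (measure_union_le _ _).trans_eq ?_
    rw [Real.volume_Icc, Real.volume_Icc, ← ENNReal.ofReal_add (by linarith) (by linarith),
      ← ENNReal.ofReal_ofNat 4, ← ENNReal.ofReal_mul (by norm_num)]
    congr 1
    ring
  calc ∫⁻ t, ENNReal.ofReal |g t - g (t + v)| ^ p
      ≤ ∫⁻ t, S.indicator (fun _ => ENNReal.ofReal (L / R * v) ^ p) t := by
        refine lintegral_mono fun t => ?_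
        by_cases ht : t ∈ S
        · rw [indicator_of_mem ht]
          refine ENNReal.rpow_le_rpow (ENNReal.ofReal_le_ofReal ((hlip _ _).trans_eq ?_)) hp.le
          rw [sub_add_cancel_left, abs_neg, abs_of_nonneg hv]
        · have e1 : g t = 0 := hsupp t (by
            by_contra! hcon
            exact ht (Or.inl (abs_le.1 hcon)))
          have e2 : g (t + v) = 0 := hsupp _ (by
            by_contra! hcon
            have := abs_le.1 hcon
            exact ht (Or.inr ⟨by linarith, by linarith⟩))
          rw [e1, e2]
          simp [hp]
    _ = ENNReal.ofReal (L / R * v) ^ p * volume S := by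
        rw [lintegral_indicator hSm, setLIntegral_const]
    _ ≤ _ := by gcongr; exact hvol.trans (by gcongr)

/-- The almost-extremality of slowly varying profiles. -/
lemma lintegral_sub_exp_mul_shift_le (hp : 1 ≤ p) (hγ : 0 < γ) {g : ℝ → ℝ} (hg : Measurable g)
    {L R : ℝ} (hL : 0 ≤ L) (hR : 0 < R)
    (hlip : ∀ t u, |g t - g u| ≤ L / R * |t - u|) (hsupp : ∀ t, 2 * R < |t| → g t = 0)
    (hone : ∀ t, |t| ≤ R → g t = 1) {v : ℝ} (hv : 0 ≤ v) :
    ∫⁻ t, ENNReal.ofReal |g t - Real.exp (-γ * v) * g (t + v)| ^ p ≤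
      ENNReal.ofReal (1 + 4 * L / (γ * R)) ^ p * (ENNReal.ofReal (1 - Real.exp (-γ * v)) ^ p *
        ∫⁻ t, ENNReal.ofReal |g t| ^ p) := by
  have hp0 : 0 < p := zero_lt_one.trans_le hp
  set c := Real.exp (-γ * v) with hc
  have hc0 : 0 ≤ c := (Real.exp_pos _).le
  have hc1 : c ≤ 1 := by
    rw [hc, Real.exp_le_one_iff]
    have := mul_nonneg hγ.le hv
    linarith
  -- This is `1 + γv ≤ e^(γv)` multiplied by `c`. It makes the shift error proportional to the main
  -- term `1 - c`, uniformly in `v`.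
  have hcv : c * v ≤ (1 - c) / γ := by
    rw [le_div_iff₀ hγ]
    have h1 := Real.add_one_le_exp (γ * v)
    have h2 : c * Real.exp (γ * v) = 1 := by
      rw [hc, ← Real.exp_add]
      simp
    nlinarith
  set G := ∫⁻ t, ENNReal.ofReal |g t| ^ p with hG
  have hmink := ENNReal.lintegral_Lp_add_le (μ := volume) (p := p)
    (f := fun t => ENNReal.ofReal (1 - c) * ENNReal.ofReal |g t|)
    (g := fun t => ENNReal.ofReal c * ENNReal.ofReal |g t - g (t + v)|)
    (by fun_prop) (by fun_prop) hp
  have hle : ∫⁻ t, ENNReal.ofReal |g t - c * g (t + v)| ^ p ≤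
      ∫⁻ t, ((fun t => ENNReal.ofReal (1 - c) * ENNReal.ofReal |g t|) +
        fun t => ENNReal.ofReal c * ENNReal.ofReal |g t - g (t + v)|) t ^ p := by
    refine lintegral_mono fun t => ENNReal.rpow_le_rpow ?_ hp0.le
    rw [Pi.add_apply, ← ENNReal.ofReal_mul hc0, ← ENNReal.ofReal_mul (by linarith),
      ← ENNReal.ofReal_add (mul_nonneg (by linarith) (abs_nonneg _)) (by positivity)]
    refine ENNReal.ofReal_le_ofReal ?_
    have := abs_add_le ((1 - c) * g t) (c * (g t - g (t + v)))
    rw [abs_mul, abs_mul, abs_of_nonneg hc0, abs_of_nonneg (by linarith : 0 ≤ 1 - c)] at this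
    refine le_trans (le_of_eq ?_) this
    congr 1
    ring
  have e1 : (∫⁻ t, (ENNReal.ofReal (1 - c) * ENNReal.ofReal |g t|) ^ p) ^ (1 / p) =
      ENNReal.ofReal (1 - c) * G ^ (1 / p) := by
    simp only [ENNReal.mul_rpow_of_nonneg _ _ hp0.le]
    rw [lintegral_const_mul' _ _ (by finiteness),
      ENNReal.mul_rpow_of_nonneg _ _ (by positivity : 0 ≤ 1 / p),
      ← ENNReal.rpow_mul, mul_one_div_cancel hp0.ne', ENNReal.rpow_one]
  have e2 : (∫⁻ t, (ENNReal.ofReal c * ENNReal.ofReal |g t - g (t + v)|) ^ p) ^ (1 / p) ≤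
      ENNReal.ofReal ((1 - c) * (4 * L / (γ * R))) * G ^ (1 / p) := by
    simp only [ENNReal.mul_rpow_of_nonneg _ _ hp0.le]
    rw [lintegral_const_mul' _ _ (by finiteness),
      ENNReal.mul_rpow_of_nonneg _ _ (by positivity : 0 ≤ 1 / p),
      ← ENNReal.rpow_mul, mul_one_div_cancel hp0.ne', ENNReal.rpow_one]
    have h1 := ENNReal.rpow_le_rpow (lintegral_sub_shift_le hp0 hR hlip hsupp hone hv)
      (by positivity : 0 ≤ 1 / p)
    rw [ENNReal.mul_rpow_of_nonneg _ _ (by positivity : 0 ≤ 1 / p),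
      ← ENNReal.rpow_mul, mul_one_div_cancel hp0.ne', ENNReal.rpow_one,
      ENNReal.mul_rpow_of_nonneg _ _ (by positivity : 0 ≤ 1 / p)] at h1
    have h4 : (4 : ℝ≥0∞) ^ (1 / p) ≤ ENNReal.ofReal 4 := by
      rw [ENNReal.ofReal_ofNat]
      calc (4 : ℝ≥0∞) ^ (1 / p) ≤ 4 ^ (1 : ℝ) :=
            ENNReal.rpow_le_rpow_of_exponent_le (by norm_num) ((div_le_one hp0).2 hp)
        _ = 4 := ENNReal.rpow_one _
    calc _ ≤ ENNReal.ofReal c *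
          (ENNReal.ofReal (L / R * v) * (ENNReal.ofReal 4 * G ^ (1 / p))) := by
          gcongr
          exact h1.trans (by gcongr)
      _ = ENNReal.ofReal (c * v * (4 * L / R)) * G ^ (1 / p) := by
          rw [← mul_assoc, ← mul_assoc, ← ENNReal.ofReal_mul hc0,
            ← ENNReal.ofReal_mul (by positivity)]
          congr 2
          ring
      _ ≤ _ := by
          refine mul_le_mul_left (ENNReal.ofReal_le_ofReal ?_) _
          calc c * v * (4 * L / R) ≤ (1 - c) / γ * (4 * L / R) := by gcongr
            _ = _ := by field_simp
  have h3 := (ENNReal.rpow_le_rpow hle (by positivity : 0 ≤ 1 / p)).trans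
    (hmink.trans (add_le_add e1.le e2))
  have hnn : 0 ≤ 4 * L / (γ * R) := by positivity
  rw [← add_mul, ← ENNReal.ofReal_add (by linarith) (mul_nonneg (by linarith) hnn),
    ← mul_one_add (1 - c), mul_comm (1 - c), ENNReal.ofReal_mul (by linarith)] at h3
  have h4 := ENNReal.rpow_le_rpow h3 hp0.le
  rwa [ENNReal.mul_rpow_of_nonneg _ _ hp0.le, ENNReal.mul_rpow_of_nonneg _ _ hp0.le,
    ← ENNReal.rpow_mul, ← ENNReal.rpow_mul, one_div_mul_cancel hp0.ne', ENNReal.rpow_one,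
    ENNReal.rpow_one, mul_assoc] at h4

theorem energy_le_of_radial (h : Admissible N p s β γ) (hx : ‖x‖ = 1) (hφ : Measurable φ)
    {g : ℝ → ℝ} (hg : Measurable g) (hφg : logProfile N γ φ = fun _ => g)
    {L R : ℝ} (hL : 0 ≤ L) (hR : 0 < R)
    (hlip : ∀ t u, |g t - g u| ≤ L / R * |t - u|) (hsupp : ∀ t, 2 * R < |t| → g t = 0)
    (hone : ∀ t, |t| ≤ R → g t = 1) :
    energy N p s β φ ≤ ENNReal.ofReal (1 + 4 * L / (γ * R)) ^ p *
      ENNReal.ofReal (2 * Lam N p s β γ x) * hardyTerm N p s β φ := by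
  have hγ := h.γ_pos
  have hps := h.ps_pos
  rw [energy_eq_lintegral_slice h hφ, hardyTerm_eq h hφ, hφg, ENNReal.ofReal_mul zero_le_two,
    ENNReal.ofReal_ofNat, mul_left_comm, mul_assoc, lintegral_const,
    mul_comm _ (sphereMeasure N univ)]
  refine mul_le_mul_right ?_ _
  set G := ∫⁻ t, ENNReal.ofReal |g t| ^ p with hG
  set q := ENNReal.ofReal (1 + 4 * L / (γ * R)) ^ p with hq
  have hm : Measurable fun v => ENNReal.ofReal (Real.exp (((N : ℝ) - β) * v)) *
      (ENNReal.ofReal (1 - Real.exp (-γ * v)) ^ p *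
        sphereLIntegral N (N + p * s) x (Real.exp v)) := by
    have := measurable_sphereLIntegral N (N + p * s) x
    fun_prop
  rw [mul_comm q, mul_assoc, ← lintegral_log_eq_Lam h hx, ← lintegral_mul_const _ hm]
  refine setLIntegral_mono' measurableSet_Ioi fun v hv => ?_
  have hv0 : 0 < v := hv
  rw [mul_assoc]
  refine mul_le_mul_right ?_ _
  rw [sliceEnergy_radial hx hg]
  calc _ ≤ sphereLIntegral N (N + p * s) x (Real.exp v) * (sphereMeasure N univ *
        (q * (ENNReal.ofReal (1 - Real.exp (-γ * v)) ^ p * G))) := by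
        gcongr
        exact lintegral_sub_exp_mul_shift_le h.one_lt_p.le hγ hg hL hR hlip hsupp hone hv0.le
    _ = _ := by ring

/-- The radial test function `‖x‖ ^ (-γ) f(log ‖x‖ / R)`. -/
def radialTest (N : ℕ) (γ : ℝ) (f : ℝ → ℝ) (R : ℝ) (x : Space N) : ℝ :=
  ‖x‖ ^ (-γ) * f (Real.log ‖x‖ / R)

lemma logProfile_radialTest (f : ℝ → ℝ) (R : ℝ) :
    logProfile N γ (radialTest N γ f R) = fun _ t => f (t / R) := by
  ext θ t
  rw [logProfile, radialTest, norm_smul, norm_coe_sphere, mul_one, Real.norm_eq_abs, Real.abs_exp,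
    Real.log_exp, ← Real.exp_mul, ← mul_assoc, ← Real.exp_add]
  rw [show γ * t + t * -γ = 0 by ring, Real.exp_zero, one_mul]

lemma radialTest_eq_zero (hγ : 0 < γ) {f : ℝ → ℝ} (hf : ∀ t, 2 ≤ |t| → f t = 0) {R : ℝ}
    (hR : 0 < R) {x : Space N} (hx : ‖x‖ ≤ Real.exp (-(2 * R)) ∨ Real.exp (2 * R) ≤ ‖x‖) :
    radialTest N γ f R x = 0 := by
  rw [radialTest]
  rcases eq_or_ne x 0 with rfl | h0
  -- At the origin the convention `0 ^ (-γ) = 0` supplies the desired value.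
  · rw [norm_zero, Real.zero_rpow (neg_ne_zero.2 hγ.ne'), zero_mul]
  · rw [hf, mul_zero]
    have hpos : 0 < ‖x‖ := norm_pos_iff.2 h0
    rw [abs_div, abs_of_pos hR, le_div_iff₀ hR, le_abs']
    rcases hx with hx | hx
    · left
      exact (Real.log_le_iff_le_exp hpos).2 hx
    · right
      exact (Real.le_log_iff_exp_le hpos).2 hx

/-- The function vanishes on a ball around the origin, the only point where the norm and its
logarithm fail to be smooth. -/
lemma contDiff_radialTest (hγ : 0 < γ) {f : ℝ → ℝ} (hf : ∀ t, 2 ≤ |t| → f t = 0)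
    (hfs : ContDiff ℝ ∞ f) {R : ℝ} (hR : 0 < R) : ContDiff ℝ ∞ (radialTest N γ f R) := by
  rw [contDiff_iff_contDiffAt]
  intro x
  rcases eq_or_ne x 0 with rfl | h0
  · refine (contDiffAt_const (c := (0 : ℝ))).congr_of_eventuallyEq ?_
    filter_upwards [Metric.closedBall_mem_nhds (0 : Space N) (Real.exp_pos (-(2 * R)))] with y hy
    exact radialTest_eq_zero hγ hf hR (Or.inl (by simpa using hy))
  · have hn : ContDiffAt ℝ ∞ (fun y : Space N => ‖y‖) x := contDiffAt_norm ℝ h0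
    have hne : ‖x‖ ≠ 0 := norm_ne_zero_iff.2 h0
    exact (hn.rpow_const_of_ne hne).mul
      (hfs.contDiffAt.comp x ((hn.log hne).div_const R))

lemma hasCompactSupport_radialTest (hγ : 0 < γ) {f : ℝ → ℝ} (hf : ∀ t, 2 ≤ |t| → f t = 0) {R : ℝ}
    (hR : 0 < R) : HasCompactSupport (radialTest N γ f R) := by
  refine HasCompactSupport.intro (isCompact_closedBall (0 : Space N) (Real.exp (2 * R)))
    fun y hy => radialTest_eq_zero hγ hf hR (Or.inr ?_)
  rw [mem_closedBall_zero_iff, not_le] at hy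
  exact hy.le

lemma exists_bump : ∃ f : ℝ → ℝ, ∃ L : ℝ, 0 ≤ L ∧ ContDiff ℝ ∞ f ∧
    (∀ t u, |f t - f u| ≤ L * |t - u|) ∧ (∀ t, 2 ≤ |t| → f t = 0) ∧ ∀ t, |t| ≤ 1 → f t = 1 := by
  let f : ContDiffBump (0 : ℝ) := ⟨1, 2, one_pos, one_lt_two⟩
  have hf : ContDiff ℝ ∞ f := f.contDiff
  obtain ⟨L, hL⟩ := hf.lipschitzWith_of_hasCompactSupport f.hasCompactSupport (by simp)
  refine ⟨f, L, L.2, hf, fun t u => ?_, fun t ht => f.zero_of_le_dist ?_,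
    fun t ht => f.one_of_mem_closedBall ?_⟩
  · have := hL.dist_le_mul t u
    rwa [Real.dist_eq, Real.dist_eq] at this
  · simpa using ht
  · simpa using ht

end UpperBound

/-! ### Finiteness of both integrals and positivity of the Hardy term -/

section Finiteness

variable {N : ℕ} {p s β γ : ℝ} {φ : Space N → ℝ}

lemma exists_bounds (hφ : ContDiff ℝ ∞ φ) (hc : HasCompactSupport φ) :
    ∃ M : ℝ, 0 < M ∧ (∀ x, |φ x| ≤ M) ∧ (∀ x y, |φ x - φ y| ≤ M * ‖x - y‖) ∧
      ∀ x, M < ‖x‖ → φ x = 0 := by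
  obtain ⟨L, hL⟩ := hφ.lipschitzWith_of_hasCompactSupport hc (by simp)
  obtain ⟨C, hC⟩ := hc.exists_bound_of_continuous hφ.continuous
  obtain ⟨R, hR⟩ := hc.isCompact.isBounded.subset_closedBall 0
  -- One number serves as bound, Lipschitz constant and support radius.
  refine ⟨max 1 (max (max C R) L), lt_max_of_lt_left one_pos, fun x => ?_, fun x y => ?_,
    fun x hx => ?_⟩
  · exact (hC x).trans (((le_max_left C R).trans (le_max_left _ _)).trans (le_max_right _ _))
  · have h1 := hL.dist_le_mul x y
    rw [Real.dist_eq, dist_eq_norm] at h1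
    refine h1.trans (mul_le_mul_of_nonneg_right ?_ (norm_nonneg _))
    exact (le_max_right _ _).trans (le_max_right _ _)
  · by_contra h0
    have h1 := hR (subset_tsupport _ h0)
    rw [mem_closedBall_zero_iff] at h1
    have h2 : R ≤ max 1 (max (max C R) L) :=
      ((le_max_right C R).trans (le_max_left _ _)).trans (le_max_right _ _)
    linarith

theorem hardyTerm_ne_top (h : Admissible N p s β γ) (hφ : ContDiff ℝ ∞ φ)
    (hc : HasCompactSupport φ) : hardyTerm N p s β φ ≠ ⊤ := by
  obtain ⟨M, hM0, hM, -, hsupp⟩ := exists_bounds hφ hc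
  have hS : MeasurableSet {x : Space N | ‖x‖ ≤ M} := measurableSet_le (by fun_prop) (by fun_prop)
  have hle : hardyTerm N p s β φ ≤ ∫⁻ x : Space N, {x : Space N | ‖x‖ ≤ M}.indicator
      (fun x => ENNReal.ofReal (M ^ p) * ENNReal.ofReal (‖x‖ ^ (p * γ - N))) x := by
    refine lintegral_mono fun x => ?_
    by_cases hx : x ∈ {x : Space N | ‖x‖ ≤ M}
    · rw [indicator_of_mem hx, ← ENNReal.ofReal_mul (by positivity)]
      refine ENNReal.ofReal_le_ofReal ?_
      rw [h.p_mul_γ, show (N : ℝ) - p * s - 2 * β - N = -(p * s + 2 * β) by ring,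
        Real.rpow_neg (norm_nonneg _), div_eq_mul_inv]
      have := h.p_pos
      gcongr
      exact hM x
    · rw [hsupp x (not_le.1 hx), abs_zero, Real.zero_rpow h.p_pos.ne', zero_div,
        ENNReal.ofReal_zero]
      exact zero_le
  refine ne_top_of_le_ne_top ?_ hle
  rw [lintegral_indicator hS, lintegral_const_mul' _ _ ENNReal.ofReal_ne_top,
    lintegral_norm_rpow_ball h.one_le_N (mul_pos h.p_pos h.γ_pos) hM0]
  finiteness

theorem hardyTerm_ne_zero (h : Admissible N p s β γ) (hφ : Continuous φ) (h0 : φ ≠ 0) :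
    hardyTerm N p s β φ ≠ 0 := by
  intro hz
  have := nontrivial_space h.one_le_N
  rw [hardyTerm, lintegral_eq_zero_iff (by fun_prop)] at hz
  refine h0 ((Continuous.ae_eq_iff_eq volume hφ continuous_const).1 ?_)
  filter_upwards [hz, measure_eq_zero_iff_ae_notMem.1
    (measure_singleton (μ := volume) (0 : Space N))] with x hx hx0
  have hpos : 0 < ‖x‖ := norm_pos_iff.2 hx0
  by_contra hne
  have h1 : 0 < |φ x| := abs_pos.2 hne
  have : 0 < |φ x| ^ p / ‖x‖ ^ (p * s + 2 * β) := by positivity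
  simp only [Pi.zero_apply, ENNReal.ofReal_eq_zero] at hx
  linarith

/-- Pairs of points with comparable norms. -/
lemma energyDensity_le_of_le (h : Admissible N p s β γ) {M : ℝ} (hM0 : 0 < M)
    (hL : ∀ x y, |φ x - φ y| ≤ M * ‖x - y‖) {x y : Space N} (hx : x ≠ 0) (hxy : ‖x‖ < ‖y‖)
    (hy : ‖y‖ ≤ 2 * ‖x‖) :
    energyDensity N p s β φ x y ≤ ENNReal.ofReal (2 ^ |β| * M ^ p * ‖x‖ ^ (-(2 * β))) *
      ENNReal.ofReal (‖x - y‖ ^ (p - p * s - N)) := by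
  have hx0 : 0 < ‖x‖ := norm_pos_iff.2 hx
  have hy0 : 0 < ‖y‖ := hx0.trans hxy
  have hd : 0 < ‖x - y‖ := by
    rw [norm_pos_iff, sub_ne_zero]
    rintro rfl
    exact lt_irrefl _ hxy
  rw [energyDensity, ← ENNReal.ofReal_mul (by positivity)]
  refine ENNReal.ofReal_le_ofReal ?_
  have e1 : |φ x - φ y| ^ p ≤ M ^ p * ‖x - y‖ ^ p := by
    rw [← Real.mul_rpow hM0.le hd.le]
    exact Real.rpow_le_rpow (abs_nonneg _) (hL x y) h.p_pos.le
  have e2 : ‖y‖ ^ (-β) ≤ 2 ^ |β| * ‖x‖ ^ (-β) := by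
    rcases le_or_gt 0 β with hβ | hβ
    · calc ‖y‖ ^ (-β) ≤ ‖x‖ ^ (-β) :=
            Real.rpow_le_rpow_of_nonpos hx0 hxy.le (by linarith)
        _ ≤ 2 ^ |β| * ‖x‖ ^ (-β) :=
            le_mul_of_one_le_left (by positivity)
              (Real.one_le_rpow one_le_two (abs_nonneg _))
    · rw [abs_of_neg hβ, ← Real.mul_rpow zero_le_two hx0.le]
      exact Real.rpow_le_rpow hy0.le hy (by linarith)
  calc |φ x - φ y| ^ p / (‖x - y‖ ^ ((N : ℝ) + p * s) * ‖x‖ ^ β * ‖y‖ ^ β)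
      = |φ x - φ y| ^ p * (‖x - y‖ ^ (-((N : ℝ) + p * s)) * ‖x‖ ^ (-β) * ‖y‖ ^ (-β)) := by
        rw [Real.rpow_neg hd.le, Real.rpow_neg hx0.le, Real.rpow_neg hy0.le, div_eq_mul_inv,
          mul_inv, mul_inv]
    _ ≤ (M ^ p * ‖x - y‖ ^ p) *
        (‖x - y‖ ^ (-((N : ℝ) + p * s)) * ‖x‖ ^ (-β) * (2 ^ |β| * ‖x‖ ^ (-β))) := by gcongr
    _ = _ := by
        rw [show p - p * s - N = p + (-((N : ℝ) + p * s)) by ring, Real.rpow_add hd,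
          show -(2 * β) = -β + -β by ring, Real.rpow_add hx0]
        ring

/-- Pairs of points with incomparable norms. -/
lemma energyDensity_le_of_lt (h : Admissible N p s β γ) {x y : Space N} (hx : x ≠ 0)
    (hy : 2 * ‖x‖ < ‖y‖) :
    energyDensity N p s β φ x y ≤
      ENNReal.ofReal (2 ^ p * 2 ^ ((N : ℝ) + p * s) * (|φ x| ^ p * ‖x‖ ^ (-β))) *
        ENNReal.ofReal (‖y‖ ^ (-(p * s + β) - N)) +
      ENNReal.ofReal (2 ^ p * 2 ^ ((N : ℝ) + p * s) * (|φ y| ^ p * ‖y‖ ^ (-(p * s + β) - N))) *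
        ENNReal.ofReal (‖x‖ ^ ((N : ℝ) - β - N)) := by
  have hx0 : 0 < ‖x‖ := norm_pos_iff.2 hx
  have hy0 : 0 < ‖y‖ := by linarith
  have hps := h.ps_pos
  have hd2 : ‖y‖ / 2 ≤ ‖x - y‖ := by
    have := norm_sub_norm_le y x
    rw [norm_sub_rev] at this
    linarith
  have hd : 0 < ‖x - y‖ := by linarith
  rw [energyDensity, ← ENNReal.ofReal_mul (by positivity), ← ENNReal.ofReal_mul (by positivity),
    ← ENNReal.ofReal_add (by positivity) (by positivity)]
  refine ENNReal.ofReal_le_ofReal ?_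
  have e1 : |φ x - φ y| ^ p ≤ 2 ^ p * (|φ x| ^ p + |φ y| ^ p) := by
    have h1 : |φ x - φ y| ≤ 2 * max |φ x| |φ y| := by
      have := abs_sub (φ x) (φ y)
      linarith [le_max_left |φ x| |φ y|, le_max_right |φ x| |φ y|]
    have h2 : (max |φ x| |φ y|) ^ p ≤ |φ x| ^ p + |φ y| ^ p := by
      have p1 : 0 ≤ |φ x| ^ p := by positivity
      have p2 : 0 ≤ |φ y| ^ p := by positivity
      rcases max_choice |φ x| |φ y| with h | h <;> rw [h] <;> linarith
    calc _ ≤ (2 * max |φ x| |φ y|) ^ p := Real.rpow_le_rpow (abs_nonneg _) h1 h.p_pos.le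
      _ = 2 ^ p * (max |φ x| |φ y|) ^ p :=
          Real.mul_rpow zero_le_two (le_max_of_le_left (abs_nonneg _))
      _ ≤ _ := by gcongr
  have e2 : ‖x - y‖ ^ (-((N : ℝ) + p * s)) ≤
      2 ^ ((N : ℝ) + p * s) * ‖y‖ ^ (-((N : ℝ) + p * s)) := by
    refine (Real.rpow_le_rpow_of_nonpos (by positivity) hd2
      (neg_nonpos.2 (by positivity))).trans_eq ?_
    rw [Real.div_rpow hy0.le zero_le_two, Real.rpow_neg zero_le_two, div_inv_eq_mul, mul_comm]
  calc |φ x - φ y| ^ p / (‖x - y‖ ^ ((N : ℝ) + p * s) * ‖x‖ ^ β * ‖y‖ ^ β)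
      = |φ x - φ y| ^ p * (‖x - y‖ ^ (-((N : ℝ) + p * s)) * ‖x‖ ^ (-β) * ‖y‖ ^ (-β)) := by
        rw [Real.rpow_neg hd.le, Real.rpow_neg hx0.le, Real.rpow_neg hy0.le, div_eq_mul_inv,
          mul_inv, mul_inv]
    _ ≤ (2 ^ p * (|φ x| ^ p + |φ y| ^ p)) *
        ((2 ^ ((N : ℝ) + p * s) * ‖y‖ ^ (-((N : ℝ) + p * s))) * ‖x‖ ^ (-β) * ‖y‖ ^ (-β)) := by
        gcongr
    _ = _ := by
        rw [show -(p * s + β) - N = -((N : ℝ) + p * s) + -β by ring, Real.rpow_add hy0,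
          show (N : ℝ) - β - N = -β by ring]
        ring

/-- For comparable norms the Lipschitz bound makes the kernel integrable on the diagonal, as `ps <
p`. For `‖y‖ > 2‖x‖` the kernel is of size `‖y‖^(-N-ps)`, and each of `|φ x|^p`, `|φ y|^p` leads to
a multiple of the Hardy term. -/
theorem energy_ne_top (h : Admissible N p s β γ) (hφ : ContDiff ℝ ∞ φ)
    (hc : HasCompactSupport φ) : energy N p s β φ ≠ ⊤ := by
  have := nontrivial_space h.one_le_N
  obtain ⟨M, hM0, -, hL, hsupp⟩ := exists_bounds hφ hc
  have hN := h.one_le_N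
  have hφm : Measurable φ := hφ.continuous.measurable
  have hD := hardyTerm_ne_top h hφ hc
  have hd : 0 < p - p * s := sub_pos.2 h.ps_lt_p
  have hpsβ : 0 < p * s + β := by linarith [h.lt_β]
  have hNβ : 0 < (N : ℝ) - β := by
    have h1 := h.β_lt
    have h2 := h.ps_pos
    have h3 := h.ps_lt
    linarith
  have hball : ∀ r : ℝ, MeasurableSet {z : Space N | ‖z‖ ≤ r} := fun r =>
    measurableSet_le (by fun_prop) (by fun_prop)
  have hcompl : ∀ r : ℝ, MeasurableSet {z : Space N | r ≤ ‖z‖} := fun r =>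
    measurableSet_le (by fun_prop) (by fun_prop)
  set c := (2 : ℝ) ^ p * 2 ^ ((N : ℝ) + p * s) with hcdef
  have hc0 : 0 < c := by positivity
  -- `A` majorizes the pairs with `‖y‖ ≤ 2‖x‖`, hence `‖x - y‖ ≤ 3‖x‖`. `B` and `B'` carry `|φ x|^p`
  -- and `|φ y|^p` on the rest; their inner integrals converge because `ps + β > 0` and `β < N`
  -- respectively.
  let A : Space N → Space N → ℝ≥0∞ := fun x y => {x : Space N | ‖x‖ ≤ M}.indicator
    (fun x => ENNReal.ofReal (2 ^ |β| * M ^ p * ‖x‖ ^ (-(2 * β))) *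
      {z : Space N | ‖z‖ ≤ 3 * ‖x‖}.indicator
        (fun z => ENNReal.ofReal (‖z‖ ^ (p - p * s - N))) (x - y)) x
  let B : Space N → Space N → ℝ≥0∞ := fun x y =>
    ENNReal.ofReal (c * (|φ x| ^ p * ‖x‖ ^ (-β))) * {y : Space N | 2 * ‖x‖ ≤ ‖y‖}.indicator
      (fun y => ENNReal.ofReal (‖y‖ ^ (-(p * s + β) - N))) y
  let B' : Space N → Space N → ℝ≥0∞ := fun x y =>
    ENNReal.ofReal (c * (|φ y| ^ p * ‖y‖ ^ (-(p * s + β) - N))) *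
      {x : Space N | ‖x‖ ≤ ‖y‖ / 2}.indicator (fun x => ENNReal.ofReal (‖x‖ ^ ((N : ℝ) - β - N))) x
  have hBm : ∀ x, Measurable (B x) := fun x =>
    ((by fun_prop : Measurable fun y : Space N =>
      ENNReal.ofReal (‖y‖ ^ (-(p * s + β) - N))).indicator (hcompl _)).const_mul _
  have hB'm : Measurable (Function.uncurry B') := by
    refine Measurable.mul (by fun_prop) (Measurable.indicator
      (s := {z : Space N × Space N | ‖z.1‖ ≤ ‖z.2‖ / 2})
      (f := fun z : Space N × Space N => ENNReal.ofReal (‖z.1‖ ^ ((N : ℝ) - β - N)))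
      (by fun_prop) (measurableSet_le (by fun_prop) (by fun_prop)))
  have hae : ∀ᵐ x : Space N, x ≠ 0 :=
    measure_eq_zero_iff_ae_notMem.1 (measure_singleton (μ := volume) (0 : Space N))
  have hbound : ∀ x : Space N, x ≠ 0 → ∀ y,
      halfDensity N p s β φ x y ≤ A x y + B x y + B' x y := by
    intro x hx y
    have hx0 : 0 < ‖x‖ := norm_pos_iff.2 hx
    by_cases hxy : y ∈ {y : Space N | ‖x‖ < ‖y‖}
    swap
    · rw [halfDensity, indicator_of_notMem hxy]
      exact zero_le
    rw [halfDensity, indicator_of_mem hxy]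
    have hxy' : ‖x‖ < ‖y‖ := hxy
    rcases le_or_gt ‖y‖ (2 * ‖x‖) with hy | hy
    · rw [add_assoc]
      refine le_add_right ?_
      by_cases hxM : ‖x‖ ≤ M
      · have hz : x - y ∈ {z : Space N | ‖z‖ ≤ 3 * ‖x‖} := by
          have := norm_sub_le x y
          change ‖x - y‖ ≤ 3 * ‖x‖
          linarith
        simp only [A]
        rw [indicator_of_mem (show x ∈ {x : Space N | ‖x‖ ≤ M} from hxM), indicator_of_mem hz]
        exact energyDensity_le_of_le h hM0 hL hx hxy' hy
      · rw [energyDensity, hsupp x (not_le.1 hxM), hsupp y ((not_le.1 hxM).trans hxy'), sub_zero,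
          abs_zero, Real.zero_rpow h.p_pos.ne', zero_div, ENNReal.ofReal_zero]
        exact zero_le
    · rw [add_assoc]
      refine le_add_left ?_
      simp only [B, B']
      rw [indicator_of_mem (show y ∈ {y : Space N | 2 * ‖x‖ ≤ ‖y‖} from hy.le),
        indicator_of_mem (show x ∈ {x : Space N | ‖x‖ ≤ ‖y‖ / 2} by
          change ‖x‖ ≤ ‖y‖ / 2
          linarith)]
      exact energyDensity_le_of_lt h hx hy
  have hA : ∫⁻ x, ∫⁻ y, A x y ≠ ⊤ := by
    set C := sphereMeasure N univ * ENNReal.ofReal (2 ^ |β| * M ^ p * 3 ^ (p - p * s) / (p - p * s))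
      with hC
    have hle : ∫⁻ x, ∫⁻ y, A x y ≤ ∫⁻ x : Space N, {x : Space N | ‖x‖ ≤ M}.indicator
        (fun x => C * ENNReal.ofReal (‖x‖ ^ (p * γ + p - N))) x := by
      refine lintegral_mono_ae (hae.mono fun x hx => ?_)
      have hx0 : 0 < ‖x‖ := norm_pos_iff.2 hx
      by_cases hxM : x ∈ {x : Space N | ‖x‖ ≤ M}
      · simp only [A, indicator_of_mem hxM]
        rw [lintegral_const_mul' _ _ ENNReal.ofReal_ne_top, lintegral_sub_left_eq_self
          ({z : Space N | ‖z‖ ≤ 3 * ‖x‖}.indicator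
            (fun z => ENNReal.ofReal (‖z‖ ^ (p - p * s - N)))) x, lintegral_indicator (hball _),
          lintegral_norm_rpow_ball hN hd (by positivity), hC, mul_left_comm,
          mul_assoc (sphereMeasure N univ), ← ENNReal.ofReal_mul (by positivity),
          ← ENNReal.ofReal_mul (by positivity)]
        refine le_of_eq ?_
        congr 2
        rw [Real.mul_rpow (by norm_num) hx0.le,
          show p * γ + p - N = -(2 * β) + (p - p * s) by rw [h.p_mul_γ]; ring, Real.rpow_add hx0]
        ring
      · simp only [A, indicator_of_notMem hxM, lintegral_zero]
        exact zero_le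
    refine ne_top_of_le_ne_top ?_ hle
    have hpγ := mul_pos h.p_pos h.γ_pos
    rw [lintegral_indicator (hball M), lintegral_const_mul' _ _ (by finiteness),
      lintegral_norm_rpow_ball hN (by linarith [h.p_pos]) hM0]
    finiteness
  have hB : ∫⁻ x, ∫⁻ y, B x y ≠ ⊤ := by
    set C := sphereMeasure N univ * ENNReal.ofReal (c * 2 ^ (-(p * s + β)) / (p * s + β)) with hC
    have hle : ∫⁻ x, ∫⁻ y, B x y ≤ C * hardyTerm N p s β φ := by
      rw [hardyTerm, ← lintegral_const_mul' _ _ (by finiteness)]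
      refine lintegral_mono_ae (hae.mono fun x hx => ?_)
      have hx0 : 0 < ‖x‖ := norm_pos_iff.2 hx
      simp only [B]
      rw [lintegral_const_mul' _ _ ENNReal.ofReal_ne_top, lintegral_indicator (hcompl _),
        lintegral_norm_rpow_compl_ball hN hpsβ (by positivity), hC, mul_left_comm,
        mul_assoc (sphereMeasure N univ), ← ENNReal.ofReal_mul (by positivity),
        ← ENNReal.ofReal_mul (by positivity)]
      refine le_of_eq ?_
      congr 2
      rw [Real.mul_rpow (by norm_num) hx0.le, div_eq_mul_inv (|φ x| ^ p),
        ← Real.rpow_neg hx0.le, show -(p * s + 2 * β) = -β + -(p * s + β) by ring,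
        Real.rpow_add hx0]
      ring
    exact ne_top_of_le_ne_top (by finiteness) hle
  have hB' : ∫⁻ x, ∫⁻ y, B' x y ≠ ⊤ := by
    set C := sphereMeasure N univ * ENNReal.ofReal (c * 2⁻¹ ^ ((N : ℝ) - β) / ((N : ℝ) - β)) with hC
    have hle : ∫⁻ x, ∫⁻ y, B' x y ≤ C * hardyTerm N p s β φ := by
      rw [lintegral_lintegral_swap hB'm.aemeasurable, hardyTerm,
        ← lintegral_const_mul' _ _ (by finiteness)]
      refine lintegral_mono_ae (hae.mono fun y hy => ?_)
      have hy0 : 0 < ‖y‖ := norm_pos_iff.2 hy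
      simp only [B']
      rw [lintegral_const_mul' _ _ ENNReal.ofReal_ne_top, lintegral_indicator (hball _),
        lintegral_norm_rpow_ball hN hNβ (by positivity), hC, mul_left_comm,
        mul_assoc (sphereMeasure N univ), ← ENNReal.ofReal_mul (by positivity),
        ← ENNReal.ofReal_mul (by positivity)]
      refine le_of_eq ?_
      congr 2
      rw [div_eq_mul_inv ‖y‖, Real.mul_rpow hy0.le (by norm_num), div_eq_mul_inv (|φ y| ^ p),
        ← Real.rpow_neg hy0.le,
        show -(p * s + 2 * β) = (-(p * s + β) - N) + ((N : ℝ) - β) by ring, Real.rpow_add hy0]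
      ring
    exact ne_top_of_le_ne_top (by finiteness) hle
  have hBx : Measurable fun x => ∫⁻ y, B x y := by
    have : Measurable (Function.uncurry B) := by
      refine Measurable.mul (by fun_prop) (Measurable.indicator
        (s := {z : Space N × Space N | 2 * ‖z.1‖ ≤ ‖z.2‖})
        (f := fun z : Space N × Space N => ENNReal.ofReal (‖z.2‖ ^ (-(p * s + β) - N)))
        (by fun_prop) (measurableSet_le (by fun_prop) (by fun_prop)))
    exact this.lintegral_prod_right'
  have hB'x : Measurable fun x => ∫⁻ y, B' x y := hB'm.lintegral_prod_right'
  rw [energy_eq_two_mul hN hφm]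
  refine ENNReal.mul_ne_top (by finiteness) ?_
  refine ne_top_of_le_ne_top (ENNReal.add_ne_top.2 ⟨ENNReal.add_ne_top.2 ⟨hA, hB⟩, hB'⟩) ?_
  rw [← lintegral_add_right _ hBx, ← lintegral_add_right _ hB'x]
  refine lintegral_mono_ae (hae.mono fun x hx => ?_)
  rw [← lintegral_halfDensity]
  refine (lintegral_mono (hbound x hx)).trans_eq ?_
  rw [lintegral_add_right _ hB'm.of_uncurry_left, lintegral_add_right _ (hBm x)]

end Finiteness

/-! ### The best constant -/

section BestConstant

variable {N : ℕ} {p s β γ : ℝ} {x : Space N}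

theorem bestConstant_eq (h : Admissible N p s β γ) (hx : ‖x‖ = 1) :
    bestConstant N p s β = ENNReal.ofReal (2 * Lam N p s β γ x) := by
  have hγ := h.γ_pos
  refine le_antisymm ?_ ?_
  · obtain ⟨f, L, hL, hf, hlip, hsupp, hone⟩ := exists_bump
    have hle : ∀ R : ℝ, 0 < R → bestConstant N p s β ≤
        ENNReal.ofReal (1 + 4 * L / (γ * R)) ^ p * ENNReal.ofReal (2 * Lam N p s β γ x) := by
      intro R hR
      have hsmooth := contDiff_radialTest (N := N) hγ hsupp hf hR
      have hcomp := hasCompactSupport_radialTest (N := N) hγ hsupp hR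
      have hne : radialTest N γ f R ≠ 0 := by
        intro h0
        have h1 := congrFun h0 x
        rw [radialTest, hx, Real.log_one, zero_div, hone 0 (by simp), Real.one_rpow, mul_one]
          at h1
        exact one_ne_zero h1
      refine (iInf_le _ ⟨radialTest N γ f R, hsmooth, hcomp, hne⟩).trans ?_
      refine ENNReal.div_le_of_le_mul ?_
      have hfm : Measurable f := hf.continuous.measurable
      refine energy_le_of_radial h hx hsmooth.continuous.measurable (g := fun t => f (t / R))
        (by fun_prop) (logProfile_radialTest f R) hL hR (fun t u => ?_) (fun t ht => ?_)
        (fun t ht => ?_)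
      · refine (hlip _ _).trans_eq ?_
        rw [← sub_div, abs_div, abs_of_pos hR]
        ring
      · refine hsupp _ ?_
        rw [abs_div, abs_of_pos hR, le_div_iff₀ hR]
        exact ht.le
      · refine hone _ ?_
        rw [abs_div, abs_of_pos hR, div_le_iff₀ hR, one_mul]
        exact ht
    have hlim : Tendsto (fun R : ℝ => ENNReal.ofReal (1 + 4 * L / (γ * R)) ^ p *
        ENNReal.ofReal (2 * Lam N p s β γ x)) atTop
        (𝓝 (ENNReal.ofReal (2 * Lam N p s β γ x))) := by
      -- `L` belongs to the fixed bump `f`, so only `R` varies in the error.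
      have h1 : Tendsto (fun R : ℝ => 1 + 4 * L / (γ * R)) atTop (𝓝 (1 + 0)) :=
        tendsto_const_nhds.add
          ((tendsto_id.const_mul_atTop hγ).const_div_atTop (4 * L))
      have h2 := (ENNReal.tendsto_ofReal h1).ennrpow_const p
      have h3 := ENNReal.Tendsto.mul_const (b := ENNReal.ofReal (2 * Lam N p s β γ x)) h2
        (Or.inr ENNReal.ofReal_ne_top)
      simpa using h3
    refine ge_of_tendsto hlim ?_
    filter_upwards [eventually_gt_atTop 0] with R hR using hle R hR
  · refine le_iInf fun φ => ?_
    obtain ⟨φ, hφ, hc, h0⟩ := φ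
    have hD := hardyTerm_ne_top h hφ hc
    rw [ENNReal.le_div_iff_mul_le (Or.inl (hardyTerm_ne_zero h hφ.continuous h0)) (Or.inl hD)]
    exact Lam_mul_hardyTerm_le_energy h hx hφ.continuous.measurable hD

end BestConstant

end WeightedHardy

end

/-! ### The main theorem -/

theorem theorem2p7 (N : ℕ) (p s β γ₀ : ℝ) (hp : 1 < p) (hs₀ : 0 < s) (hs₁ : s < 1)
    (hN : p * s < (N : ℝ)) (hβ₀ : -(p * s) < β) (hβ₁ : β < ((N : ℝ) - p * s) / 2)
    (hγ₀ : γ₀ = ((N : ℝ) - p * s - 2 * β) / p)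
    (x' : EuclideanSpace ℝ (Fin N)) (hx' : ‖x'‖ = 1) :
    -- the quotients are genuine ones: for nonzero test functions both integrals are finite,
    -- and the denominator is not zero
    (∀ φ : EuclideanSpace ℝ (Fin N) → ℝ, ContDiff ℝ ∞ φ → HasCompactSupport φ → φ ≠ 0 →
      WeightedHardy.energy N p s β φ ≠ ⊤ ∧
      WeightedHardy.hardyTerm N p s β φ ≠ 0 ∧ WeightedHardy.hardyTerm N p s β φ ≠ ⊤) ∧
    -- the number `Λ(γ₀)` is well defined and positive, in both of its forms
    IntegrableOn (WeightedHardy.lambdaIntegrand N p s β γ₀ x') (Ioi 1) ∧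
    WeightedHardy.HasPVIntegral (WeightedHardy.psi N p s β γ₀ x')
      (WeightedHardy.Lam N p s β γ₀ x') ∧
    0 < WeightedHardy.Lam N p s β γ₀ x' ∧
    -- the best constant
    WeightedHardy.bestConstant N p s β =
      ENNReal.ofReal (2 * WeightedHardy.Lam N p s β γ₀ x') ∧
    -- the unweighted case
    (β = 0 → WeightedHardy.IsFrankSeiringerConstant N p s x'
      (WeightedHardy.bestConstant N p s β).toReal) := by
  have h : WeightedHardy.Admissible N p s β γ₀ :=
    ⟨hp, hs₀, hs₁, hN, hβ₀, hβ₁, by rw [hγ₀, mul_div_cancel₀ _ (zero_lt_one.trans hp).ne']⟩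
  have hLam := WeightedHardy.Lam_pos h hx'
  have hpv := WeightedHardy.hasPVIntegral_psi h hx'
  have hbest := WeightedHardy.bestConstant_eq h hx'
  refine ⟨fun φ hφ hc h0 => ⟨WeightedHardy.energy_ne_top h hφ hc,
    WeightedHardy.hardyTerm_ne_zero h hφ.continuous h0, WeightedHardy.hardyTerm_ne_top h hφ hc⟩,
    WeightedHardy.integrableOn_lambdaIntegrand h hx', hpv, hLam, hbest, fun hβ => ?_⟩
  rw [hbest, ENNReal.toReal_ofReal (by positivity)]
  have hfun : (fun σ : ℝ => 2 * (|1 - σ ^ (-(((N : ℝ) - p * s) / p))| ^ (p - 2) *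
      (1 - σ ^ (-(((N : ℝ) - p * s) / p))) * σ ^ ((N : ℝ) - 1) *
      WeightedHardy.sphereKernel N p s x' σ)) =
      fun σ => 2 * WeightedHardy.psi N p s β γ₀ x' σ := by
    ext σ
    rw [WeightedHardy.psi, hγ₀, hβ, mul_zero, sub_zero, sub_zero]
  rw [WeightedHardy.IsFrankSeiringerConstant, hfun]
  refine ⟨fun ε hε => (hpv.1 ε hε).const_mul 2, ?_⟩
  simp only [integral_const_mul]
  exact hpv.2.const_mul 2
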